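/- Let $E$ be $[0,\infty)$ or $(0,\infty)$. Consider a triple $(\lambda,f,\phi)$ satisfying the following PDMP assumptions: - the flow $\phi:E\times[0,\infty)\to E$ is $C^1$, with $\phi(x,0)=x$ and $\phi(x,t+s)=\phi(\phi(x,s),t)$; for each $t\ge 0$, $\phi(\cdot,t)$ is a homeomorphism onto its image; for each $x\in E$, $\phi_x:=\phi(x,\cdot)$ is a $C^1$-diffeomorphism of $[0,\infty)$ onto $[x,\infty)$; - the jump rate $\lambda:E\to[0,\infty)$ is measurable, and for every $x\in E$ there is $\varepsilon>0$ with $\int_0^\varepsilon\lambda(\phi(x,s))\,ds<\infty$; - $f:E\to E$ is an increasing $C^1$-diffeomorphism. Started from $x\in E$, the process follows $t\mapsto\phi(x,t)$ until its first jump time $T_1$, which has law $\lambda(\phi(x,t))\exp\big(-\int_0^t\lambda(\phi(x,s))\,ds\big)\,dt$ on $[0,\infty)$; it then jumps to $Z_1=f(\phi(x,T_1))$, and starts afresh from there. Let $(Z_n)_{n\ge 0}$ be the chain of post-jump locations and $\mathcal P_\lambda(x,\cdot)$ its transition kernel, i.e. the law of $Z_1$ given $Z_0=x$. For $x\in E$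 and $y\ge f(x)$ put $g_x(y)=\big[(f\circ\phi_x)'\big((f\circ\phi_x)^{-1}(y)\big)\big]^{-1}$. Fix $b>0$, positive constants $\mathfrak c=(r,\kappa,l,L,a)$ with $\kappa<1$, and functions $m,M$ on $[0,\infty)$ with $0<m\le M$. Let $\mathcal F(\mathfrak c,m,M)$ be the class of triples $(\lambda,f,\phi)$ of continuous functions such that $$\int_0^{f(r)}M(s)\lambda(f^{-1}(s))\,ds\le L,\qquad \int_{f(r)}^\infty m(s)\lambda(f^{-1}(s))\,ds=\infty,\qquad \int_{f(r)}^{r}M(s)\lambda(f^{-1}(s))\,ds\ge l,$$ $$\lambda(x)\ge \frac{a f(x)^b}{m(f(x))}\ \ \text{for all } x\ge r,\qquad 0<f(x)\le\kappa x\ \ \text{for all } x>0,$$ $$m(y)\le g_x(y)\le M(y)\ \ \text{for all } x\in E \text{ and all } y>0 \text{ with } y\ge f(x).$$ Set $\mathbb V(x)=\exp\big(\tfrac{a}{b+1}f(x)^{b+1}\big)$ for $x\in E$. Then there exist $0<\gamma<1$ and a constant $R$, depending only on $E,b,\mathfrak c,m,M$, such that for every triple $(\lambda,f,\phi)\in\mathcal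 F(\mathfrak c,m,M)$ satisfying the PDMP assumptions: 1. the chain $(Z_n)$ has a unique invariant probability measure on $E$, and it is of the form $\nu_\lambda(dx)=\nu_\lambda(x)\,dx$; 2. $\mathbb V$ is $\nu_\lambda$-integrable; 3. for every $x\in E$, every $k\ge 0$ and every measurable $\psi$ with $|\psi|\le\mathbb V$ on $E$, $\psi$ is $\mathcal P_\lambda^k(x,\cdot)$-integrable and $$\Big|\mathcal P_\lambda^k\psi(x)-\int_E\psi(z)\nu_\lambda(z)\,dz\Big|\le R\,\mathbb V(x)\,\gamma^k;$$ 4. the density $\nu_\lambda$ can be chosen so that, for every $y\in E$, $$\lambda(y)\,\mathbb E_{\nu_\lambda}\Big[g_{Z_0}(f(y))\,\mathbf 1_{\{f(Z_0)\le f(y)\}}\mathbf 1_{\{Z_1\ge f(y)\}}\Big]=\nu_\lambda(f(y)),$$ where under $\mathbb E_{\nu_\lambda}$ the chain starts from $Z_0\sim\nu_\lambda$, and the expectation is finite. -/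

import Mathlib

open Set MeasureTheory ProbabilityTheory

noncomputable section

namespace PDMP

/-- Standing assumptions on the local characteristics `(lam, f, φ)` of the process: `lam` is the jump
rate, `f` gives the location after a jump and `φ x t` is the flow started from `x`.
The state space `E` (the half-line) is `[0, ∞)` or `(0, ∞)`; the latter covers flows such as
`φ x t = x * exp t`, for which `0` is a fixed point. Values of the functions for states outside `E`
or for negative times play no role. -/
structure Assumptions (E : Set ℝ) (lam f : ℝ → ℝ) (φ : ℝ → ℝ → ℝ) : Prop where
  state_space : E = Ici 0 ∨ E = Ioi 0
  flow_contDiffOn : ContDiffOn ℝ 1 (fun p : ℝ × ℝ => φ p.1 p.2) (E ×ˢ Ici 0)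
  flow_zero : ∀ x ∈ E, φ x 0 = x
  flow_add : ∀ x ∈ E, ∀ s, 0 ≤ s → ∀ t, 0 ≤ t → φ x (t + s) = φ (φ x s) t
  /-- `φ (·, t)` is a homeomorphism onto its image. -/
  flow_embedding : ∀ t, 0 ≤ t → Topology.IsEmbedding (fun x : E => φ x t)
  /-- `φ (x, ·)` is a `C¹`-diffeomorphism from `[0, ∞)` onto `[x, ∞)`. -/
  flow_bijOn : ∀ x ∈ E, BijOn (φ x) (Ici 0) (Ici x)
  flow_deriv_ne : ∀ x ∈ E, ∀ t, 0 ≤ t → derivWithin (φ x) (Ici 0) t ≠ 0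
  rate_nonneg : ∀ x ∈ E, 0 ≤ lam x
  rate_measurable : Measurable (E.domRestrict lam)
  rate_locallyIntegrable : ∀ x ∈ E, ∃ ε > 0,
    IntervalIntegrable (fun s => lam (φ x s)) volume 0 ε
  /-- `f` is an increasing `C¹`-diffeomorphism of `E`. -/
  jump_strictMonoOn : StrictMonoOn f E
  jump_bijOn : BijOn f E E
  jump_contDiffOn : ContDiffOn ℝ 1 f E
  jump_deriv_ne : ∀ x ∈ E, derivWithin f E x ≠ 0

/-- The cumulated jump rate `Λ(x, t) = ∫₀ᵗ lam (φ(x, s)) ds`. -/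
def cumRate (lam : ℝ → ℝ) (φ : ℝ → ℝ → ℝ) (x t : ℝ) : ℝ :=
  ∫ s in (0 : ℝ)..t, lam (φ x s)

/-- The law on `[0, ∞)` of the first jump time `T₁` (on the event `T₁ < ∞`) of the process started
from `x`: `ℙ_x(T₁ ∈ dt) = lam (φ(x, t)) exp (-Λ(x, t)) dt`. -/
def jumpTimeLaw (lam : ℝ → ℝ) (φ : ℝ → ℝ → ℝ) (x : ℝ) : Measure ℝ :=
  (volume.restrict (Ici 0)).withDensity
    (fun t => ENNReal.ofReal (lam (φ x t) * Real.exp (-cumRate lam φ x t)))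

open scoped Classical in
/-- The law of the post-jump location `Z₁ = f (φ(x, T₁))` of the process started from `x ∈ E`
(and the zero measure if `x ∉ E`). -/
def postJumpLaw (E : Set ℝ) (lam f : ℝ → ℝ) (φ : ℝ → ℝ → ℝ) (x : ℝ) : Measure ℝ :=
  if x ∈ E then (jumpTimeLaw lam φ x).map (fun t => f (φ x t)) else 0

section Measurability

variable {E : Set ℝ} {lam f : ℝ → ℝ} {φ : ℝ → ℝ → ℝ}

theorem Assumptions.measurableSet (h : Assumptions E lam f φ) : MeasurableSet E := by
  rcases h.state_space with h | h <;> rw [h]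
  · exact measurableSet_Ici
  · exact measurableSet_Ioi

theorem Assumptions.flow_mem (h : Assumptions E lam f φ) {x t : ℝ} (hx : x ∈ E) (ht : 0 ≤ t) :
    φ x t ∈ E := by
  have h1 : x ≤ φ x t := (h.flow_bijOn x hx).mapsTo ht
  rcases h.state_space with h | h <;> rw [h] at hx ⊢
  · exact le_trans hx h1
  · exact lt_of_lt_of_le hx h1

theorem Assumptions.measurable_flow (h : Assumptions E lam f φ) :
    Measurable (fun p : ↥(E ×ˢ Ici (0 : ℝ)) => φ p.1.1 p.1.2) :=
  (continuousOn_iff_continuous_domRestrict.1 h.flow_contDiffOn.continuousOn).measurable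

theorem measurable_indicator_of_restrict {α β : Type*} [MeasurableSpace α] [MeasurableSpace β]
    [Zero β] {s : Set α} (hs : MeasurableSet s) {u : α → β} (hu : Measurable (s.domRestrict u)) :
    Measurable (s.indicator u) := by
  refine measurable_of_restrict_of_restrict_compl hs ?_ ?_
  · have : s.domRestrict (s.indicator u) = s.domRestrict u := by
      ext x
      simp [x.2]
    rwa [this]
  · have : sᶜ.domRestrict (s.indicator u) = fun _ => 0 := by
      ext x
      simpa using indicator_of_notMem x.2 u
    rw [this]
    exact measurable_const

theorem Assumptions.measurable_comp_flow (h : Assumptions E lam f φ) {u : ℝ → ℝ}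
    (hu : Measurable (E.domRestrict u)) :
    Measurable ((E ×ˢ Ici (0 : ℝ)).indicator (fun p => u (φ p.1 p.2))) := by
  refine measurable_indicator_of_restrict (h.measurableSet.prod measurableSet_Ici) ?_
  have h1 : Measurable (fun p : ↥(E ×ˢ Ici (0 : ℝ)) =>
      (⟨φ p.1.1 p.1.2, h.flow_mem p.2.1 p.2.2⟩ : E)) := h.measurable_flow.subtype_mk
  exact hu.comp h1

theorem Assumptions.measurable_cumRate (h : Assumptions E lam f φ) :
    Measurable ((E ×ˢ Ici (0 : ℝ)).indicator (fun p => cumRate lam φ p.1 p.2)) := by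
  set G := (E ×ˢ Ici (0 : ℝ)).indicator (fun p => lam (φ p.1 p.2)) with hG
  have hGm : Measurable G := h.measurable_comp_flow h.rate_measurable
  have hS : MeasurableSet {q : (ℝ × ℝ) × ℝ | 0 < q.2 ∧ q.2 ≤ q.1.2} :=
    (measurableSet_lt measurable_const measurable_snd).inter
      (measurableSet_le measurable_snd (measurable_snd.comp measurable_fst))
  have hF : Measurable ({q : (ℝ × ℝ) × ℝ | 0 < q.2 ∧ q.2 ≤ q.1.2}.indicator
      (fun q => G (q.1.1, q.2))) :=
    (hGm.comp ((measurable_fst.comp measurable_fst).prodMk measurable_snd)).indicator hS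
  have hI : Measurable (fun p : ℝ × ℝ => ∫ s, ({q : (ℝ × ℝ) × ℝ | 0 < q.2 ∧ q.2 ≤ q.1.2}.indicator
      (fun q => G (q.1.1, q.2))) (p, s)) :=
    hF.stronglyMeasurable.integral_prod_right'.measurable
  convert hI.indicator (h.measurableSet.prod (measurableSet_Ici (a := (0 : ℝ)))) using 1
  refine indicator_congr ?_
  rintro ⟨x, t⟩ ⟨hx, ht⟩
  simp only [cumRate]
  rw [intervalIntegral.integral_of_le ht, ← integral_indicator measurableSet_Ioc]
  refine integral_congr_ae (Filter.Eventually.of_forall fun s => ?_)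
  by_cases hs : 0 < s ∧ s ≤ t
  · have h2 : (x, s) ∈ E ×ˢ Ici (0 : ℝ) := ⟨hx, hs.1.le⟩
    simp [indicator, hs, hG, hx, hs.1.le]
  · simp only [indicator, mem_Ioc, mem_ofPred_eq, hs, if_false]

theorem Assumptions.measurable_jumpTimeDensity (h : Assumptions E lam f φ) :
    Measurable ((E ×ˢ Ici (0 : ℝ)).indicator (fun p =>
      ENNReal.ofReal (lam (φ p.1 p.2) * Real.exp (-cumRate lam φ p.1 p.2)))) := by
  have h1 := h.measurable_comp_flow h.rate_measurable
  convert (h1.mul (Real.measurable_exp.comp h.measurable_cumRate.neg)).ennreal_ofReal using 1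
  ext p
  by_cases hp : p ∈ E ×ˢ Ici (0 : ℝ) <;> simp [hp]

theorem Assumptions.jump_measurable (h : Assumptions E lam f φ) : Measurable (E.domRestrict f) :=
  (continuousOn_iff_continuous_domRestrict.1 h.jump_contDiffOn.continuousOn).measurable

theorem Assumptions.measurable_postJump (h : Assumptions E lam f φ) {x : ℝ} (hx : x ∈ E) :
    Measurable ((Ici (0 : ℝ)).indicator (fun t => f (φ x t))) := by
  convert (h.measurable_comp_flow h.jump_measurable).comp (measurable_prodMk_left (x := x)) using 1
  ext t
  by_cases ht : 0 ≤ t <;> simp [indicator, hx, ht]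

theorem Assumptions.aemeasurable_postJump (h : Assumptions E lam f φ) {x : ℝ} (hx : x ∈ E) :
    AEMeasurable (fun t => f (φ x t)) (jumpTimeLaw lam φ x) := by
  refine AEMeasurable.mono_ac (ν := volume.restrict (Ici 0)) ?_ (withDensity_absolutelyContinuous _ _)
  exact (aemeasurable_indicator_iff measurableSet_Ici).1 (h.measurable_postJump hx).aemeasurable

theorem Assumptions.measurable_postJumpLaw (h : Assumptions E lam f φ) :
    Measurable (postJumpLaw E lam f φ) := by
  refine Measure.measurable_of_measurable_coe _ fun A hA => ?_
  have hfm := h.measurable_comp_flow h.jump_measurable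
  have hK : Measurable (((E ×ˢ Ici (0 : ℝ)).indicator (fun p =>
      ENNReal.ofReal (lam (φ p.1 p.2) * Real.exp (-cumRate lam φ p.1 p.2)))) *
      ((E ×ˢ Ici (0 : ℝ)).indicator (fun p => f (φ p.1 p.2)) ⁻¹' A).indicator 1) :=
    h.measurable_jumpTimeDensity.mul (measurable_one.indicator (hfm hA))
  convert hK.lintegral_prod_right' (ν := volume) using 1
  ext x
  by_cases hx : x ∈ E
  · have hset : MeasurableSet ((Ici (0 : ℝ)).indicator (fun t => f (φ x t)) ⁻¹' A) :=
      h.measurable_postJump hx hA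
    have hd : jumpTimeLaw lam φ x ((fun t => f (φ x t)) ⁻¹' A) =
        jumpTimeLaw lam φ x ((Ici (0 : ℝ)).indicator (fun t => f (φ x t)) ⁻¹' A) := by
      refine measure_congr ?_
      have : ∀ᵐ t ∂(jumpTimeLaw lam φ x), t ∈ Ici (0 : ℝ) :=
        (withDensity_absolutelyContinuous _ _).ae_le (ae_restrict_mem measurableSet_Ici)
      filter_upwards [this] with t ht
      simp only [eq_iff_iff]
      change f (φ x t) ∈ A ↔ (Ici (0 : ℝ)).indicator (fun t => f (φ x t)) t ∈ A
      rw [indicator_of_mem ht]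
    rw [postJumpLaw, if_pos hx, Measure.map_apply_of_aemeasurable (h.aemeasurable_postJump hx) hA,
      hd, jumpTimeLaw, withDensity_apply _ hset, Measure.restrict_restrict hset,
      ← lintegral_indicator (hset.inter measurableSet_Ici)]
    refine lintegral_congr fun t => ?_
    by_cases ht : 0 ≤ t
    · by_cases hA' : f (φ x t) ∈ A <;> simp [indicator, mem_preimage, hx, ht, hA']
    · simp [indicator, ht]
  · simp [postJumpLaw, hx]

end Measurability

/-- The transition kernel of the chain `(Zₙ)` of post-jump locations. States outside `E` are sent to
the zero measure, so an invariant probability measure is automatically carried by `E`. -/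
def postJumpKernel {E : Set ℝ} {lam f : ℝ → ℝ} {φ : ℝ → ℝ → ℝ} (h : Assumptions E lam f φ) :
    Kernel ℝ ℝ where
  toFun := postJumpLaw E lam f φ
  measurable' := h.measurable_postJumpLaw

/-- `g_x(y) = 1 / (f ∘ φ_x)'((f ∘ φ_x)⁻¹(y))`, meaningful for `x ∈ E` and `y ≥ f x`, that is for `y`
in the range of `f ∘ φ_x` on `[0, ∞)`. -/
def gFun (f : ℝ → ℝ) (φ : ℝ → ℝ → ℝ) (x y : ℝ) : ℝ :=
  (derivWithin (fun t => f (φ x t)) (Ici 0)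
    (Function.invFunOn (fun t => f (φ x t)) (Ici 0) y))⁻¹

/-- The class `𝓕(𝔠, m, M)` of triples `(lam, f, φ)`, where `𝔠 = (r, κ, l, L, a)`; it also depends on
the exponent `b`. The integrals are those of nonnegative functions, with values in `[0, ∞]`. -/
structure MemClass (E : Set ℝ) (b r κ l L a : ℝ) (m M : ℝ → ℝ)
    (lam f : ℝ → ℝ) (φ : ℝ → ℝ → ℝ) : Prop where
  rate_continuousOn : ContinuousOn lam E
  jump_continuousOn : ContinuousOn f E
  flow_continuousOn : ContinuousOn (fun p : ℝ × ℝ => φ p.1 p.2) (E ×ˢ Ici 0)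
  integral_le : ∫⁻ s in Ioo 0 (f r), ENNReal.ofReal (M s * lam (Function.invFunOn f E s)) ≤
    ENNReal.ofReal L
  integral_eq_top : ∫⁻ s in Ioi (f r), ENNReal.ofReal (m s * lam (Function.invFunOn f E s)) = ⊤
  le_integral : ENNReal.ofReal l ≤
    ∫⁻ s in Ioo (f r) r, ENNReal.ofReal (M s * lam (Function.invFunOn f E s))
  rate_ge : ∀ x, r ≤ x → a * (f x) ^ b / m (f x) ≤ lam x
  jump_bounds : ∀ x, 0 < x → 0 < f x ∧ f x ≤ κ * x
  g_bounds : ∀ y, 0 < y → ∀ x ∈ E, f x ≤ y → m y ≤ gFun f φ x y ∧ gFun f φ x y ≤ M y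

/-- The Lyapunov function `𝕍(x) = exp (a / (b + 1) * f(x) ^ (b + 1))`. -/
def lyapunov (a b : ℝ) (f : ℝ → ℝ) (x : ℝ) : ℝ :=
  Real.exp (a / (b + 1) * (f x) ^ (b + 1))

/-- The measure `ν(dx) = ν(x) dx` with density `ν` on the real line. -/
def densityMeasure (ν : ℝ → ℝ) : Measure ℝ :=
  volume.withDensity (fun x => ENNReal.ofReal (ν x))

end PDMP

end

/-! The proof verifies the hypotheses of Harris' theorem with constants that see only `E, b, r, κ,
L, a, m`, and then reads the density off the transition kernel.

Harris' theorem is proved by the weighted-oscillation method: one measures a test function by its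
oscillation relative to `1 + β W`, and shows that `P ^ n` contracts this seminorm. For two points
where `W` is large in sum, the drift inequality contracts; otherwise both points lie in a sublevel
set where `P ^ n` dominates a common measure (`Harris.Condition.osc_contraction`). Iteration gives
uniformly Cauchy laws, hence an invariant measure, its uniqueness and the geometric rate.

Write `U = potential a b`, so that `𝕍 = exp (U ∘ f)`. Above `r`, the lower bound on the rate says
exactly that the cumulated rate `Λ` grows at least as fast as `U (f (φ x t))`
(`MemClass.potential_sub_le`). Since `Z₁ = f (φ x T₁)` and `f z ≤ κ z`, the homogeneity of `U` gives
`U (f Z₁) ≤ κ ^ (b + 1) * U Z₁ ≤ κ ^ (b + 1) * (p + Λ(x, T₁))` with `p = max (U (f x)) (U r)`. As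
`Λ(x, T₁)` is a standard exponential variable and `κ ^ (b + 1) < 1`, the expectation of `𝕍 Z₁` is at
most a constant times `𝕍 x` to a power below one, up to a floor: this is the drift.

For the minorization, the chain started in a sublevel set of `𝕍` descends below `r` in a bounded
number of jumps with probability bounded below. From any `x ≤ r` the flow reaches `r` before a jump
with probability at least `exp (-L)`, and then `Z₁` has the law it has from `r`.

Finally, by the semigroup property `g_x(w)` does not depend on `x`. Hence `Z₁` has a hazard rate
common to all starting points, and integrating the kernel against the invariant measure gives the
density `hazard w * ℙ(f Z₀ ≤ w ≤ Z₁)`, which is the identity of item 4. -/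

noncomputable section

open Filter Topology

/-! ### Harris' theorem: contraction of the weighted oscillation. -/

namespace Harris

variable {X : Type*}

/-- `ψ` has oscillation at most `c` for the weight `1 + β W`. -/
def Osc (E : Set X) (β : ℝ) (W ψ : X → ℝ) (c : ℝ) : Prop :=
  ∀ x ∈ E, ∀ y ∈ E, |ψ x - ψ y| ≤ c * ((1 + β * W x) + (1 + β * W y))

/-- Every lower envelope value `ψ x - c (1 + β W x)` lies below every upper one `ψ y + c (1 + β W
y)`, so the supremum of the former separates the two families. Up to an additive constant, bounded
oscillation is thus a weighted sup-norm bound, which can be integrated. -/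
theorem Osc.exists_center {E : Set X} {W : X → ℝ} {β c : ℝ} {ψ : X → ℝ} (hE : E.Nonempty) (h : Osc E β W ψ c) :
    ∃ m : ℝ, ∀ x ∈ E, |ψ x - m| ≤ c * (1 + β * W x) := by
  obtain ⟨x₀, hx₀⟩ := hE
  have key : ∀ x ∈ E, ∀ y ∈ E, ψ x - c * (1 + β * W x) ≤ ψ y + c * (1 + β * W y) := by
    intro x hx y hy
    have := (abs_le.1 (h x hx y hy)).2
    linarith
  let S := (fun x => ψ x - c * (1 + β * W x)) '' E
  have hb : BddAbove S := ⟨ψ x₀ + c * (1 + β * W x₀), by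
    rintro _ ⟨x, hx, rfl⟩; exact key x hx x₀ hx₀⟩
  refine ⟨sSup S, fun x hx => abs_le.2 ⟨?_, ?_⟩⟩
  · have : sSup S ≤ ψ x + c * (1 + β * W x) := csSup_le ⟨_, x₀, hx₀, rfl⟩ (by
      rintro _ ⟨y, hy, rfl⟩; exact key y hy x hx)
    linarith
  · have : ψ x - c * (1 + β * W x) ≤ sSup S := le_csSup hb ⟨x, hx, rfl⟩
    linarith

variable [MeasurableSpace X]

/-- A kernel for which `E` is absorbing, with Lyapunov function `W`, and whose `n`-th power is minorized
on the sublevel set `{W ≤ 16 B}`. -/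
structure Condition (P : Kernel X X) (E : Set X) (W : X → ℝ) (B ε : ℝ) (n : ℕ) : Prop where
  measurableSet : MeasurableSet E
  nonempty : E.Nonempty
  prob : ∀ x ∈ E, IsProbabilityMeasure (P x)
  absorbing : ∀ x ∈ E, ∀ᵐ y ∂(P x), y ∈ E
  eq_zero : ∀ x ∉ E, P x = 0
  measurable : Measurable W
  one_le : ∀ x, 1 ≤ W x
  drift : ∀ x ∈ E, ∫⁻ y, ENNReal.ofReal (W y) ∂(P x) ≤ ENNReal.ofReal (W x / 2 + B)
  minorization : ∃ ν : Measure X, IsProbabilityMeasure ν ∧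
    ∀ x ∈ E, W x ≤ 16 * B → ENNReal.ofReal ε • ν ≤ (P ^ n) x

variable {P : Kernel X X} {E : Set X} {W : X → ℝ} {B ε : ℝ} {n : ℕ}

theorem pow_succ_apply (x : X) (k : ℕ) : (P ^ (k + 1)) x = ((P ^ k) ∘ₖ P) x := by
  rw [pow_succ]; rfl

theorem pow_add_apply (x : X) (j k : ℕ) : (P ^ (j + k)) x = ((P ^ k) ∘ₖ (P ^ j)) x := by
  rw [add_comm, pow_add]; rfl

theorem pow_zero_apply (x : X) : (P ^ 0) x = Measure.dirac x := by
  rw [pow_zero]; exact Kernel.id_apply x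

theorem ae_mem_pow (hE : MeasurableSet E) (hP : ∀ x ∈ E, ∀ᵐ y ∂(P x), y ∈ E) (k : ℕ) :
    ∀ x ∈ E, ∀ᵐ y ∂((P ^ k) x), y ∈ E := by
  induction k with
  | zero => intro x hx; rw [pow_zero_apply]; exact (ae_dirac_iff hE).2 hx
  | succ k ih =>
    intro x hx
    rw [pow_add_apply, pow_one]
    exact Kernel.ae_comp_of_ae_ae hE (by filter_upwards [ih x hx] with z hz using hP z hz)

theorem integral_pow_add {ψ : X → ℝ} (j k : ℕ) {x : X} (hi : Integrable ψ ((P ^ (j + k)) x)) :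
    ∫ z, ψ z ∂((P ^ (j + k)) x) = ∫ y, ∫ z, ψ z ∂((P ^ k) y) ∂((P ^ j) x) := by
  rw [pow_add_apply] at hi ⊢
  exact Kernel.integral_comp hi

theorem measurable_integral_pow {ψ : X → ℝ} (hψ : Measurable ψ) (k : ℕ) :
    Measurable fun x => ∫ z, ψ z ∂((P ^ k) x) :=
  hψ.stronglyMeasurable.integral_kernel.measurable

namespace Condition

theorem pow_ae_mem (h : Condition P E W B ε n) (k : ℕ) : ∀ x ∈ E, ∀ᵐ y ∂((P ^ k) x), y ∈ E :=
  ae_mem_pow h.measurableSet h.absorbing k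

theorem pow_isProbabilityMeasure (h : Condition P E W B ε n) (k : ℕ) : ∀ x ∈ E, IsProbabilityMeasure ((P ^ k) x) := by
  induction k with
  | zero => intro x hx; rw [pow_zero_apply]; infer_instance
  | succ k ih =>
    intro x hx
    have := h.prob x hx
    constructor
    rw [pow_succ_apply, Kernel.comp_apply' _ _ _ MeasurableSet.univ]
    have : ∀ᵐ y ∂(P x), (P ^ k) y univ = 1 := by
      filter_upwards [h.absorbing x hx] with y hy
      have := ih y hy
      exact measure_univ
    rw [lintegral_congr_ae this]
    simp

/-- The additive errors form a geometric series `B (1 + 1/2 + ...)`, bounded by `2 B` uniformly in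
`k`. -/
theorem pow_drift (h : Condition P E W B ε n) (hB : 0 ≤ B) (k : ℕ) : ∀ x ∈ E,
    ∫⁻ y, ENNReal.ofReal (W y) ∂((P ^ k) x) ≤ ENNReal.ofReal (W x / 2 ^ k + 2 * B) := by
  have hm : Measurable fun y => ENNReal.ofReal (W y) := h.measurable.ennreal_ofReal
  have hW : ∀ x, 0 ≤ W x := fun x => zero_le_one.trans (h.one_le x)
  induction k with
  | zero =>
    intro x hx
    rw [pow_zero_apply, lintegral_dirac' _ hm]
    exact ENNReal.ofReal_le_ofReal (by simp; linarith)
  | succ k ih =>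
    intro x hx
    have := h.pow_isProbabilityMeasure k x hx
    rw [pow_add_apply, pow_one, Kernel.lintegral_comp _ _ _ hm]
    calc ∫⁻ y, ∫⁻ z, ENNReal.ofReal (W z) ∂(P y) ∂((P ^ k) x)
        ≤ ∫⁻ y, (ENNReal.ofReal (1 / 2) * ENNReal.ofReal (W y) + ENNReal.ofReal B) ∂((P ^ k) x) := by
          refine lintegral_mono_ae ?_
          filter_upwards [h.pow_ae_mem k x hx] with y hy
          refine (h.drift y hy).trans_eq ?_
          rw [← ENNReal.ofReal_mul (by positivity), ← ENNReal.ofReal_add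
            (mul_nonneg (by positivity) (hW y)) hB]
          congr 1; ring
      _ = ENNReal.ofReal (1 / 2) * (∫⁻ y, ENNReal.ofReal (W y) ∂((P ^ k) x))
            + ENNReal.ofReal B := by
          rw [lintegral_add_left (hm.const_mul _), lintegral_const_mul _ hm]
          simp
      _ ≤ ENNReal.ofReal (1 / 2) * ENNReal.ofReal (W x / 2 ^ k + 2 * B) + ENNReal.ofReal B := by
          gcongr
          exact ih x hx
      _ = _ := by
          rw [← ENNReal.ofReal_mul (by positivity), ← ENNReal.ofReal_add
            (mul_nonneg (by positivity) (add_nonneg (div_nonneg (hW x) (by positivity))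
              (by positivity))) hB]
          congr 1; rw [pow_succ]; ring

theorem integrable_weight (h : Condition P E W B ε n) (hB : 0 ≤ B) (k : ℕ) {x : X} (hx : x ∈ E) :
    Integrable W ((P ^ k) x) := by
  refine (lintegral_ofReal_ne_top_iff_integrable h.measurable.aestronglyMeasurable
    (ae_of_all _ fun y => zero_le_one.trans (h.one_le y))).1 ?_
  exact ((h.pow_drift hB k x hx).trans_lt ENNReal.ofReal_lt_top).ne

theorem integral_weight_le (h : Condition P E W B ε n) (hB : 0 ≤ B) (k : ℕ) {x : X} (hx : x ∈ E) :
    ∫ y, W y ∂((P ^ k) x) ≤ W x / 2 ^ k + 2 * B := by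
  have hW : ∀ x, 0 ≤ W x := fun x => zero_le_one.trans (h.one_le x)
  rw [integral_eq_lintegral_of_nonneg_ae (ae_of_all _ hW) h.measurable.aestronglyMeasurable]
  refine ENNReal.toReal_le_of_le_ofReal ?_ (h.pow_drift hB k x hx)
  have := hW x
  positivity

theorem integrable_of_osc (h : Condition P E W B ε n) (hB : 0 ≤ B) {β c : ℝ} {ψ : X → ℝ} (hψ : Measurable ψ)
    (ho : Osc E β W ψ c) (k : ℕ) {x : X} (hx : x ∈ E) : Integrable ψ ((P ^ k) x) := by
  have := h.pow_isProbabilityMeasure k x hx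
  obtain ⟨m, hm⟩ := ho.exists_center h.nonempty
  have hi : Integrable (fun y => |m| + c * (1 + β * W y)) ((P ^ k) x) :=
    (integrable_const _).add (((integrable_const _).add
      ((h.integrable_weight hB k hx).const_mul β)).const_mul c)
  refine hi.mono' hψ.aestronglyMeasurable ?_
  filter_upwards [h.pow_ae_mem k x hx] with y hy
  have h1 := hm y hy
  have h2 := abs_sub_abs_le_abs_sub (ψ y) m
  rw [Real.norm_eq_abs]
  linarith

theorem integral_gauge_le (h : Condition P E W B ε n) (hB : 0 ≤ B) {β : ℝ} (hβ : 0 ≤ β) (k : ℕ) {x : X} (hx : x ∈ E) :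
    ∫ y, (1 + β * W y) ∂((P ^ k) x) ≤ 1 + β * (W x / 2 ^ k + 2 * B) := by
  have := h.pow_isProbabilityMeasure k x hx
  rw [integral_add (integrable_const _) ((h.integrable_weight hB k hx).const_mul β),
    integral_const_mul]
  have := h.integral_weight_le hB k hx
  simp only [integral_const, probReal_univ, smul_eq_mul, mul_one]
  gcongr

/-- A bound without contraction but uniform in `k`; it handles the steps left over when `k` is not a
multiple of `n`. -/
theorem osc_pow (h : Condition P E W B ε n) (hB : 0 ≤ B) {β c : ℝ} (hβ : 0 ≤ β) (hβ1 : β ≤ 1) (hc : 0 ≤ c) {ψ : X → ℝ}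
    (hψ : Measurable ψ) (ho : Osc E β W ψ c) (k : ℕ) :
    Osc E β W (fun x => ∫ z, ψ z ∂((P ^ k) x)) ((1 + 2 * B) * c) := by
  obtain ⟨m, hm⟩ := ho.exists_center h.nonempty
  have key : ∀ x ∈ E, |∫ z, ψ z ∂((P ^ k) x) - m| ≤ (1 + 2 * B) * c * (1 + β * W x) := by
    intro x hx
    have := h.pow_isProbabilityMeasure k x hx
    have hd : Integrable (fun y => 1 + β * W y) ((P ^ k) x) :=
      (integrable_const _).add ((h.integrable_weight hB k hx).const_mul β)
    have e : ∫ z, ψ z ∂((P ^ k) x) - m = ∫ z, (ψ z - m) ∂((P ^ k) x) := by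
      rw [integral_sub (h.integrable_of_osc hB hψ ho k hx) (integrable_const _)]; simp
    rw [e]
    have h1 : |∫ z, (ψ z - m) ∂((P ^ k) x)| ≤ ∫ z, c * (1 + β * W z) ∂((P ^ k) x) := by
      rw [← Real.norm_eq_abs]
      refine norm_integral_le_of_norm_le (hd.const_mul c) ?_
      filter_upwards [h.pow_ae_mem k x hx] with y hy using hm y hy
    rw [integral_const_mul] at h1
    refine h1.trans ?_
    have h2 := h.integral_gauge_le hB hβ k hx
    have hW := h.one_le x
    have h3 : W x / 2 ^ k ≤ W x := div_le_self (by linarith) (one_le_pow₀ (by norm_num))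
    have h4 : ∫ y, (1 + β * W y) ∂((P ^ k) x) ≤ (1 + 2 * B) * (1 + β * W x) := by
      refine h2.trans ?_
      have h5 : β * (W x / 2 ^ k) ≤ β * W x := by gcongr
      have h6 : β * (2 * B) ≤ 1 * (2 * B) := by gcongr
      have h7 : 0 ≤ 2 * B * (β * W x) := by positivity
      nlinarith
    calc _ ≤ c * ((1 + 2 * B) * (1 + β * W x)) := by gcongr
      _ = _ := by ring
  intro x hx y hy
  have hx' := abs_le.1 (key x hx)
  have hy' := abs_le.1 (key y hy)
  rw [abs_le]
  constructor <;> linarith [hx'.1, hx'.2, hy'.1, hy'.2]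

theorem osc_contraction (h : Condition P E W B ε n) (hB : 1 ≤ B) (hε : 0 < ε) (hε1 : ε ≤ 1) (hn : 1 ≤ n) {c : ℝ} (hc : 0 ≤ c)
    {ψ : X → ℝ} (hψ : Measurable ψ) (ho : Osc E (ε / (4 * B)) W ψ c) :
    Osc E (ε / (4 * B)) W (fun x => ∫ z, ψ z ∂((P ^ n) x)) ((1 - ε / (4 * B) / 8) * c) := by
  have hB0 : 0 ≤ B := zero_le_one.trans hB
  obtain ⟨m, hm⟩ := ho.exists_center h.nonempty
  set β := ε / (4 * B) with hβd
  -- The choice of `β` balances the two mechanisms: the drift error `2 B` at each of the two points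
  -- costs `4 B β = ε` in the weight, while the minorization will gain `2 ε`.
  have hβB : 4 * B * β = ε := by rw [hβd]; field_simp
  have hβ : 0 < β := by positivity
  have hβ4 : 4 * β ≤ ε := by nlinarith
  have hd : ∀ x ∈ E, Integrable (fun y => c * (1 + β * W y)) ((P ^ n) x) := fun x hx => by
    have := h.pow_isProbabilityMeasure n x hx
    exact ((integrable_const _).add ((h.integrable_weight hB0 n hx).const_mul β)).const_mul c
  have hφ : ∀ x ∈ E, Integrable (fun y => ψ y - m) ((P ^ n) x) := fun x hx => by
    have := h.pow_isProbabilityMeasure n x hx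
    exact (h.integrable_of_osc hB0 hψ ho n hx).sub (integrable_const _)
  have e : ∀ x ∈ E, ∫ z, ψ z ∂((P ^ n) x) = ∫ z, (ψ z - m) ∂((P ^ n) x) + m := fun x hx => by
    have := h.pow_isProbabilityMeasure n x hx
    rw [integral_sub (h.integrable_of_osc hB0 hψ ho n hx) (integrable_const _)]; simp
  have hdle : ∀ x ∈ E, ∫ y, c * (1 + β * W y) ∂((P ^ n) x) ≤ c * (1 + β * (W x / 2 + 2 * B)) := by
    intro x hx
    rw [integral_const_mul]
    have h1 := h.integral_gauge_le hB0 hβ.le n hx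
    have h3 : W x / 2 ^ n ≤ W x / 2 := by
      have := h.one_le x
      have h2 : (2 : ℝ) ^ 1 ≤ 2 ^ n := pow_le_pow_right₀ (by norm_num) hn
      rw [pow_one] at h2
      gcongr
    refine mul_le_mul_of_nonneg_left (h1.trans ?_) hc
    gcongr
  have hae : ∀ x ∈ E, ∀ᵐ y ∂((P ^ n) x), |ψ y - m| ≤ c * (1 + β * W y) := fun x hx => by
    filter_upwards [h.pow_ae_mem n x hx] with y hy using hm y hy
  -- the one-sided bound
  have key : ∀ x ∈ E, ∀ y ∈ E, ∫ z, (ψ z - m) ∂((P ^ n) x) - ∫ z, (ψ z - m) ∂((P ^ n) y)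
      ≤ (1 - β / 8) * c * ((1 + β * W x) + (1 + β * W y)) := by
    intro x hx y hy
    have hWx := h.one_le x
    have hWy := h.one_le y
    have tx := hdle x hx
    have ty := hdle y hy
    -- If `W x + W y ≥ 16 B`, halving `W` outweighs the error `4 B` and the drift alone contracts.
    -- Otherwise, as `W ≥ 0`, both points are in the minorized sublevel set.
    rcases le_total (16 * B) (W x + W y) with hs | hs
    · have h1 : ∫ z, (ψ z - m) ∂((P ^ n) x) ≤ ∫ z, c * (1 + β * W z) ∂((P ^ n) x) :=
        integral_mono_ae (hφ x hx) (hd x hx) (by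
          filter_upwards [hae x hx] with z hz using (abs_le.1 hz).2)
      have h2 : -∫ z, (ψ z - m) ∂((P ^ n) y) ≤ ∫ z, c * (1 + β * W z) ∂((P ^ n) y) := by
        rw [← integral_neg]
        exact integral_mono_ae (hφ y hy).neg (hd y hy) (by
          filter_upwards [hae y hy] with z hz
          linarith [(abs_le.1 hz).1])
      have h3 : c * (1 + β * (W x / 2 + 2 * B)) + c * (1 + β * (W y / 2 + 2 * B)) ≤
          (1 - β / 8) * c * ((1 + β * W x) + (1 + β * W y)) := by
        have h4 : β * (4 * B + 1 / 4 + β * (W x + W y) / 8) ≤ β * ((W x + W y) / 2) := by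
          have : β * (W x + W y) ≤ 1 / 4 * (W x + W y) := by
            gcongr; linarith
          gcongr
          linarith
        have := mul_le_mul_of_nonneg_left h4 hc
        linarith
      linarith
    · obtain ⟨ν, hν, hmin⟩ := h.minorization
      have hmx := hmin x hx (by linarith)
      have hmy := hmin y hy (by linarith)
      -- The functions `c (1 + β W) ∓ (ψ - m)` are nonnegative, so their integrals only decrease
      -- when the laws are replaced by the common part `ε ν`. In the sum of the two inequalities `ψ
      -- - m` cancels against `ν`, leaving a gain of at least `2 ε c`.
      have h1 : ∫ z, (c * (1 + β * W z) - (ψ z - m)) ∂(ENNReal.ofReal ε • ν) ≤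
          ∫ z, (c * (1 + β * W z) - (ψ z - m)) ∂((P ^ n) x) :=
        integral_mono_measure hmx (by
          filter_upwards [hae x hx] with z hz
          simp only [Pi.zero_apply]
          linarith [(abs_le.1 hz).2]) ((hd x hx).sub (hφ x hx))
      have h2 : ∫ z, (c * (1 + β * W z) + (ψ z - m)) ∂(ENNReal.ofReal ε • ν) ≤
          ∫ z, (c * (1 + β * W z) + (ψ z - m)) ∂((P ^ n) y) :=
        integral_mono_measure hmy (by
          filter_upwards [hae y hy] with z hz
          simp only [Pi.zero_apply]
          linarith [(abs_le.1 hz).1]) ((hd y hy).add (hφ y hy))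
      have hνd := (hd x hx).mono_measure hmx
      have hνφ := (hφ x hx).mono_measure hmx
      rw [integral_sub hνd hνφ, integral_sub (hd x hx) (hφ x hx)] at h1
      rw [integral_add hνd hνφ, integral_add (hd y hy) (hφ y hy)] at h2
      have h5 : ε * c ≤ ∫ z, c * (1 + β * W z) ∂(ENNReal.ofReal ε • ν) := by
        have : ε * c = ∫ z, c ∂(ENNReal.ofReal ε • ν) := by
          rw [integral_smul_measure]; simp [hε.le]
        rw [this]
        have : IsFiniteMeasure (ENNReal.ofReal ε • ν) := Measure.smul_finite ν ENNReal.ofReal_ne_top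
        refine integral_mono (integrable_const _) hνd fun z => ?_
        have := h.one_le z
        simp only
        nlinarith [mul_nonneg hc (mul_nonneg hβ.le (by linarith : 0 ≤ W z))]
      have h3 : c * (1 + β * (W x / 2 + 2 * B)) + c * (1 + β * (W y / 2 + 2 * B)) - 2 * (ε * c) ≤
          (1 - β / 8) * c * ((1 + β * W x) + (1 + β * W y)) := by
        have h4 : β / 4 + β * (β * (W x + W y) / 8) ≤ β * ((W x + W y) / 2) + ε := by
          have : β * (β * (W x + W y) / 8) ≤ β * ((W x + W y) / 2) := by
            have : β * (W x + W y) ≤ 1 / 4 * (W x + W y) := by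
              gcongr; linarith
            gcongr
            · linarith
            · norm_num
          linarith
        have := mul_le_mul_of_nonneg_left h4 hc
        have h6 : c * (4 * B * β) = c * ε := by rw [hβB]
        linarith
      linarith
  intro x hx y hy
  simp only
  rw [e x hx, e y hy, abs_le]
  have k1 := key x hx y hy
  have k2 := key y hy x hx
  constructor <;> linarith

theorem osc_contraction_iterate (h : Condition P E W B ε n) (hB : 1 ≤ B) (hε : 0 < ε) (hε1 : ε ≤ 1) (hn : 1 ≤ n) (j : ℕ) :
    ∀ {c : ℝ}, 0 ≤ c → ∀ {ψ : X → ℝ}, Measurable ψ → Osc E (ε / (4 * B)) W ψ c →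
    Osc E (ε / (4 * B)) W (fun x => ∫ z, ψ z ∂((P ^ (j * n)) x))
      ((1 - ε / (4 * B) / 8) ^ j * c) := by
  have hB0 : 0 ≤ B := zero_le_one.trans hB
  have hα : 0 ≤ 1 - ε / (4 * B) / 8 := by
    have : ε / (4 * B) ≤ 1 := by rw [div_le_one (by positivity)]; linarith
    linarith
  induction j with
  | zero =>
    intro c hc ψ hψ ho x hx y hy
    have e (x : X) : ∫ z, ψ z ∂((P ^ (0 * n)) x) = ψ x := by
      rw [zero_mul, pow_zero_apply, integral_dirac' _ _ hψ.stronglyMeasurable]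
    simp only [e, pow_zero, one_mul]
    exact ho x hx y hy
  | succ j ih =>
    intro c hc ψ hψ ho x hx y hy
    have e : ∀ x ∈ E, ∫ z, ψ z ∂((P ^ ((j + 1) * n)) x) =
        ∫ y, ∫ z, ψ z ∂((P ^ n) y) ∂((P ^ (j * n)) x) := fun x hx => by
      rw [add_mul, one_mul]
      exact integral_pow_add _ _ (h.integrable_of_osc hB0 hψ ho _ hx)
    simp only
    rw [e x hx, e y hy, pow_succ, mul_assoc ((1 - ε / (4 * B) / 8) ^ j)]
    exact ih (mul_nonneg hα hc) (measurable_integral_pow hψ n)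
      (h.osc_contraction hB hε hε1 hn hc hψ ho) x hx y hy

end Condition
end Harris

/-! ### Limits of measures and the geometric rate. -/

namespace Harris

variable {X : Type*} [MeasurableSpace X]

/-- A sequence of probability measures which is Cauchy, uniformly on measurable sets, converges. -/
theorem exists_limit_measure (μ : ℕ → Measure X) [∀ k, IsProbabilityMeasure (μ k)] (e : ℕ → ℝ)
    (he : Tendsto e atTop (𝓝 0))
    (hμ : ∀ k j A, MeasurableSet A → |(μ (k + j)).real A - (μ k).real A| ≤ e k) :
    ∃ π : Measure X, IsProbabilityMeasure π ∧
      ∀ k A, MeasurableSet A → |π.real A - (μ k).real A| ≤ e k := by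
  have hlim : ∀ A, MeasurableSet A → ∃ a : ℝ, Tendsto (fun k => (μ k).real A) atTop (𝓝 a) := by
    intro A hA
    refine cauchySeq_tendsto_of_complete (cauchySeq_of_le_tendsto_0 (fun k => e k + e k) ?_ ?_)
    · intro i j k hi hj
      obtain ⟨i, rfl⟩ := Nat.exists_eq_add_of_le hi
      obtain ⟨j, rfl⟩ := Nat.exists_eq_add_of_le hj
      have h1 := abs_le.1 (hμ k i A hA)
      have h2 := abs_le.1 (hμ k j A hA)
      rw [Real.dist_eq, abs_le]
      constructor <;> linarith [h1.1, h1.2, h2.1, h2.2]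
    · simpa using he.add he
  choose a ha using hlim
  have hbound : ∀ k A (hA : MeasurableSet A), |a A hA - (μ k).real A| ≤ e k := by
    intro k A hA
    have h1 : Tendsto (fun j => |(μ (k + j)).real A - (μ k).real A|) atTop
        (𝓝 |a A hA - (μ k).real A|) := by
      have := (tendsto_add_atTop_iff_nat k).2 (ha A hA)
      simp_rw [add_comm k]
      exact (this.sub_const _).abs
    exact le_of_tendsto' h1 fun j => hμ k j A hA
  have hnn : ∀ A (hA : MeasurableSet A), 0 ≤ a A hA := fun A hA =>
    ge_of_tendsto' (ha A hA) fun k => measureReal_nonneg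
  have hfin : ∀ (f : ℕ → Set X) (hf : ∀ i, MeasurableSet (f i)), Pairwise (Function.onFun Disjoint f) →
      ∀ s : Finset ℕ, ∑ i ∈ s, a (f i) (hf i) =
        a (⋃ i ∈ s, f i) (Finset.measurableSet_biUnion s fun i _ => hf i) := by
    intro f hf hd s
    refine tendsto_nhds_unique ?_ (ha _ (Finset.measurableSet_biUnion s fun i _ => hf i))
    have h1 : Tendsto (fun k => ∑ i ∈ s, (μ k).real (f i)) atTop (𝓝 (∑ i ∈ s, a (f i) (hf i))) :=
      tendsto_finsetSum s fun i _ => ha (f i) (hf i)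
    refine h1.congr fun k => ?_
    rw [measureReal_biUnion_finset (fun i _ j _ hij => hd hij) fun i _ => hf i]
  have hsum : ∀ (f : ℕ → Set X) (hf : ∀ i, MeasurableSet (f i)), Pairwise (Function.onFun Disjoint f) →
      HasSum (fun i => a (f i) (hf i)) (a (⋃ i, f i) (MeasurableSet.iUnion hf)) := by
    intro f hf hd
    -- Countable additivity passes to the limit because the error `e k` is uniform over sets: for
    -- one `k` with `e k < η / 3`, the sums for `μ k` converge, and replacing `μ k` by the limit
    -- costs `η / 3` on each side.
    refine Metric.tendsto_nhds.2 fun η hη => ?_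
    obtain ⟨k, hk⟩ := (he.eventually (gt_mem_nhds (by positivity : 0 < η / 3))).exists
    have h1 : HasSum (fun i => (μ k).real (f i)) ((μ k).real (⋃ i, f i)) := by
      have h2 := measure_iUnion (μ := μ k) hd hf
      have h3 : ∑' i, μ k (f i) ≠ ⊤ := by rw [← h2]; exact measure_ne_top _ _
      have h4 := ENNReal.hasSum_toReal h3
      rw [← ENNReal.tsum_toReal_eq fun i => measure_ne_top _ _, ← h2] at h4
      exact h4
    filter_upwards [Metric.tendsto_nhds.1 h1 (η / 3) (by positivity)] with s hs
    rw [hfin f hf hd s]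
    rw [← measureReal_biUnion_finset (fun i _ j _ hij => hd hij) (fun i _ => hf i),
      Real.dist_eq] at hs
    have b1 := abs_le.1 (hbound k _ (Finset.measurableSet_biUnion s fun i _ => hf i))
    have b2 := abs_le.1 (hbound k _ (MeasurableSet.iUnion hf))
    have b3 := abs_lt.1 hs
    rw [Real.dist_eq, abs_lt]
    constructor <;> linarith [b1.1, b1.2, b2.1, b2.2, b3.1, b3.2]
  let π : Measure X := Measure.ofMeasurable (fun A hA => ENNReal.ofReal (a A hA))
    (by
      have : a ∅ MeasurableSet.empty = 0 :=
        tendsto_nhds_unique (ha ∅ MeasurableSet.empty) (by simp)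
      rw [this, ENNReal.ofReal_zero])
    (by
      intro f hf hd
      have := hsum f hf hd
      rw [← this.tsum_eq, ENNReal.ofReal_tsum_of_nonneg (fun i => hnn _ _) this.summable])
  have hπ : ∀ A (hA : MeasurableSet A), π A = ENNReal.ofReal (a A hA) := fun A hA =>
    Measure.ofMeasurable_apply A hA
  refine ⟨π, ⟨?_⟩, fun k A hA => ?_⟩
  · have : a univ MeasurableSet.univ = 1 :=
      tendsto_nhds_unique (ha univ MeasurableSet.univ) (by simp)
    rw [hπ _ MeasurableSet.univ, this, ENNReal.ofReal_one]
  · rw [measureReal_def, hπ A hA, ENNReal.toReal_ofReal (hnn A hA)]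
    exact hbound k A hA

/-- By the layer-cake formula the integral of `g` is that of the measure of `{t ≤ g}` over `t ∈ (0,
1]`, an interval of length one, so an error uniform over sets is not amplified. -/
theorem lintegral_le_add_of_measure_le {μ ν : Measure X} {c : ENNReal}
    (h : ∀ A, MeasurableSet A → μ A ≤ ν A + c) {g : X → ℝ} (hg : Measurable g)
    (h0 : ∀ x, 0 ≤ g x) (h1 : ∀ x, g x ≤ 1) :
    ∫⁻ x, ENNReal.ofReal (g x) ∂μ ≤ ∫⁻ x, ENNReal.ofReal (g x) ∂ν + c := by
  have hsplit : ∀ ρ : Measure X, ∫⁻ x, ENNReal.ofReal (g x) ∂ρ =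
      ∫⁻ t in Ioc (0 : ℝ) 1, ρ {x | t ≤ g x} := by
    intro ρ
    rw [lintegral_eq_lintegral_meas_le ρ (ae_of_all _ h0) hg.aemeasurable,
      ← Ioc_union_Ioi_eq_Ioi (zero_le_one' ℝ), lintegral_union measurableSet_Ioi
        (Ioc_disjoint_Ioi le_rfl)]
    have : ∫⁻ t in Ioi (1 : ℝ), ρ {x | t ≤ g x} = 0 := by
      rw [setLIntegral_congr_fun (g := fun _ => 0) measurableSet_Ioi, lintegral_zero]
      intro t ht
      have : {x | t ≤ g x} = ∅ := by
        ext x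
        simpa using (h1 x).trans_lt ht
      simp [this]
    rw [this, add_zero]
  rw [hsplit, hsplit]
  calc _ ≤ ∫⁻ t in Ioc (0 : ℝ) 1, (ν {x | t ≤ g x} + c) :=
        lintegral_mono fun t => h _ (measurableSet_le measurable_const hg)
    _ = _ := by
        rw [lintegral_add_right _ measurable_const]
        simp

variable {P : Kernel X X} {E : Set X} {W : X → ℝ} {B ε : ℝ} {n : ℕ}

/-- The geometric rate. -/
def rate (B ε : ℝ) (n : ℕ) : ℝ := (1 - ε / (4 * B) / 8) ^ ((n : ℝ)⁻¹)

theorem rate_base_pos (hB : 1 ≤ B) (hε1 : ε ≤ 1) : 0 < 1 - ε / (4 * B) / 8 := by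
  have : ε / (4 * B) ≤ 1 := by rw [div_le_one (by positivity)]; linarith
  linarith

theorem rate_pos (hB : 1 ≤ B) (hε1 : ε ≤ 1) : 0 < rate B ε n :=
  Real.rpow_pos_of_pos (rate_base_pos hB hε1) _

theorem rate_lt_one (hB : 1 ≤ B) (hε : 0 < ε) (hε1 : ε ≤ 1) (hn : 1 ≤ n) : rate B ε n < 1 := by
  refine Real.rpow_lt_one (rate_base_pos hB hε1).le ?_ (by positivity)
  have : 0 < ε / (4 * B) / 8 := by positivity
  linarith

theorem rate_pow (hB : 1 ≤ B) (hε1 : ε ≤ 1) (hn : 1 ≤ n) :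
    rate B ε n ^ n = 1 - ε / (4 * B) / 8 :=
  Real.rpow_inv_natCast_pow (rate_base_pos hB hε1).le (by omega)

namespace Condition

theorem osc_geometric (h : Condition P E W B ε n) (hB : 1 ≤ B) (hε : 0 < ε) (hε1 : ε ≤ 1)
    (hn : 1 ≤ n) (k : ℕ) {c : ℝ} (hc : 0 ≤ c) {ψ : X → ℝ} (hψ : Measurable ψ)
    (ho : Osc E (ε / (4 * B)) W ψ c) :
    Osc E (ε / (4 * B)) W (fun x => ∫ z, ψ z ∂((P ^ k) x))
      ((1 + 2 * B) / (rate B ε n) ^ n * c * (rate B ε n) ^ k) := by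
  have hB0 : 0 ≤ B := zero_le_one.trans hB
  have hβ0 : 0 ≤ ε / (4 * B) := by positivity
  have hβ1 : ε / (4 * B) ≤ 1 := by rw [div_le_one (by positivity)]; linarith
  have hγ := rate_pos (n := n) hB hε1
  have hγ1 := rate_lt_one hB hε hε1 hn
  intro x hx y hy
  have hk : k / n * n + k % n = k := Nat.div_add_mod' k n
  have e : ∀ x ∈ E, ∫ z, ψ z ∂((P ^ k) x) =
      ∫ y, ∫ z, ψ z ∂((P ^ (k % n)) y) ∂((P ^ (k / n * n)) x) := fun x hx => by
    conv_lhs => rw [← hk]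
    exact integral_pow_add _ _ (h.integrable_of_osc hB0 hψ ho _ hx)
  simp only
  rw [e x hx, e y hy]
  refine (h.osc_contraction_iterate hB hε hε1 hn (k / n) (by positivity)
    (measurable_integral_pow hψ _) (h.osc_pow hB0 hβ0 hβ1 hc hψ ho (k % n)) x hx y hy).trans ?_
  have hWx := h.one_le x
  have hWy := h.one_le y
  -- The incomplete last block has fewer than `n` steps, which costs at most the factor `1 / γ ^ n`.
  have h1 : (1 - ε / (4 * B) / 8) ^ (k / n) ≤ (rate B ε n) ^ k / (rate B ε n) ^ n := by
    rw [← rate_pow hB hε1 hn, le_div_iff₀ (by positivity), ← pow_mul, ← pow_add]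
    refine pow_le_pow_of_le_one hγ.le hγ1.le ?_
    have := Nat.mod_lt k (by omega : n > 0)
    rw [mul_comm]
    omega
  calc _ ≤ (rate B ε n) ^ k / (rate B ε n) ^ n * ((1 + 2 * B) * c) *
        (1 + ε / (4 * B) * W x + (1 + ε / (4 * B) * W y)) := by gcongr
    _ = _ := by ring

end Condition

end Harris

/-! ### Invariant measure: existence, uniqueness, moment bound and convergence. -/

namespace Harris

variable {X : Type*} [MeasurableSpace X]
variable {P : Kernel X X} {E : Set X} {W : X → ℝ} {B ε : ℝ} {n : ℕ}

theorem integral_bind {μ : Measure X} {κ : Kernel X X} {ψ : X → ℝ}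
    (hψ : Integrable ψ (μ.bind κ)) : ∫ z, ψ z ∂(μ.bind κ) = ∫ x, ∫ z, ψ z ∂(κ x) ∂μ := by
  have h1 : (κ ∘ₖ Kernel.const Unit μ) () = μ.bind κ := by
    rw [Kernel.comp_apply, Kernel.const_apply]
  rw [← h1] at hψ ⊢
  rw [Kernel.integral_comp hψ, Kernel.const_apply]

theorem integrable_integral_bind {μ : Measure X} {κ : Kernel X X} {ψ : X → ℝ}
    (hψ : Integrable ψ (μ.bind κ)) : Integrable (fun x => ∫ z, ψ z ∂(κ x)) μ := by
  have h1 : (κ ∘ₖ Kernel.const Unit μ) () = μ.bind κ := by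
    rw [Kernel.comp_apply, Kernel.const_apply]
  rw [← h1] at hψ
  exact hψ.integral_comp

theorem invariant_pow {π : Measure X} (hπ : Kernel.Invariant P π) (k : ℕ) :
    Kernel.Invariant (P ^ k) π := by
  induction k with
  | zero => rw [pow_zero]; exact Measure.bind_dirac
  | succ k ih => rw [pow_succ]; exact ih.comp hπ

namespace Condition

theorem osc_indicator (h : Condition P E W B ε n) {β : ℝ} (hβ : 0 ≤ β) (A : Set X) :
    Osc E β W (A.indicator fun _ => (1 : ℝ)) 1 := by
  intro x _ y _
  have hx := mul_nonneg hβ (zero_le_one.trans (h.one_le x))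
  have hy := mul_nonneg hβ (zero_le_one.trans (h.one_le y))
  have h1 : |A.indicator (fun _ => (1 : ℝ)) x - A.indicator (fun _ => (1 : ℝ)) y| ≤ 1 := by
    by_cases h1 : x ∈ A <;> by_cases h2 : y ∈ A <;> simp [h1, h2]
  linarith

theorem abs_real_sub_le (h : Condition P E W B ε n) (hB : 1 ≤ B) (hε : 0 < ε) (hε1 : ε ≤ 1)
    (hn : 1 ≤ n) (k : ℕ) {A : Set X} (hA : MeasurableSet A) {x y : X} (hx : x ∈ E) (hy : y ∈ E) :
    |((P ^ k) x).real A - ((P ^ k) y).real A| ≤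
      (1 + 2 * B) / (rate B ε n) ^ n * (rate B ε n) ^ k *
        ((1 + ε / (4 * B) * W x) + (1 + ε / (4 * B) * W y)) := by
  have hB0 : 0 ≤ B := zero_le_one.trans hB
  have := h.osc_geometric hB hε hε1 hn k zero_le_one (measurable_one.indicator hA)
    (h.osc_indicator (by positivity) A) x hx y hy
  simp only [mul_one] at this
  have e (μ : Measure X) : ∫ z, A.indicator (1 : X → ℝ) z ∂μ = μ.real A := integral_indicator_one hA
  rwa [e, e] at this

theorem exists_invariant (h : Condition P E W B ε n) (hB : 1 ≤ B) (hε : 0 < ε) (hε1 : ε ≤ 1)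
    (hn : 1 ≤ n) : ∃ π : Measure X, IsProbabilityMeasure π ∧ Kernel.Invariant P π := by
  have hB0 : 0 ≤ B := zero_le_one.trans hB
  obtain ⟨x₀, hx₀⟩ := h.nonempty
  have hγ := rate_pos (n := n) hB hε1
  have hγ1 := rate_lt_one hB hε hε1 hn
  have hp := fun k => h.pow_isProbabilityMeasure k x₀ hx₀
  set C := (1 + 2 * B) / (rate B ε n) ^ n with hC
  have hC0 : 0 < C := by positivity
  set D := C * ((1 + ε / (4 * B) * W x₀) + (1 + ε / (4 * B) * (W x₀ + 2 * B))) with hD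
  have hW0 := h.one_le x₀
  have hD0 : 0 < D := by positivity
  set β := ε / (4 * B) with hβ
  have hβ0 : 0 < β := by positivity
  -- Conditioning on the first `j` steps, the difference is an average of `P ^ k (y, A) - P ^ k (x₀,
  -- A)` over `y` with law `P ^ j (x₀, ·)`; the mean of `W` under that law is at most `W x₀ + 2 B`
  -- for every `j`.
  have hcauchy : ∀ k j A, MeasurableSet A →
      |((P ^ (k + j)) x₀).real A - ((P ^ k) x₀).real A| ≤ D * (rate B ε n) ^ k := by
    intro k j A hA
    have hmA : Measurable fun y => ((P ^ k) y).real A := ((P ^ k).measurable_coe hA).ennreal_toReal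
    have hi : Integrable (A.indicator fun _ => (1 : ℝ)) ((P ^ (j + k)) x₀) :=
      (integrable_const _).indicator hA
    have e := integral_pow_add j k hi
    have e1 (μ : Measure X) : ∫ z, A.indicator (fun _ => (1 : ℝ)) z ∂μ = μ.real A :=
      integral_indicator_one hA
    simp only [e1] at e
    have hint : Integrable (fun y => ((P ^ k) y).real A) ((P ^ j) x₀) := by
      refine Integrable.of_bound hmA.aestronglyMeasurable 1 ?_
      filter_upwards [h.pow_ae_mem j x₀ hx₀] with y hy
      have := h.pow_isProbabilityMeasure k y hy
      rw [Real.norm_eq_abs, abs_of_nonneg measureReal_nonneg]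
      exact measureReal_le_one
    have e2 : ((P ^ (k + j)) x₀).real A - ((P ^ k) x₀).real A =
        ∫ y, (((P ^ k) y).real A - ((P ^ k) x₀).real A) ∂((P ^ j) x₀) := by
      rw [add_comm, e, integral_sub hint (integrable_const _)]; simp
    rw [e2, ← Real.norm_eq_abs]
    have hg : Integrable (fun y => C * rate B ε n ^ k * ((1 + β * W y) + (1 + β * W x₀)))
        ((P ^ j) x₀) :=
      (((integrable_const _).add ((h.integrable_weight hB0 j hx₀).const_mul β)).add
        (integrable_const _)).const_mul _
    refine (norm_integral_le_of_norm_le hg ?_).trans ?_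
    · filter_upwards [h.pow_ae_mem j x₀ hx₀] with y hy
      exact h.abs_real_sub_le hB hε hε1 hn k hA hy hx₀
    · have hd : Integrable (fun y => 1 + β * W y) ((P ^ j) x₀) :=
        (integrable_const _).add ((h.integrable_weight hB0 j hx₀).const_mul β)
      rw [integral_const_mul, integral_add hd (integrable_const _)]
      have h1 := h.integral_gauge_le hB0 hβ0.le j hx₀
      have h3 : W x₀ / 2 ^ j ≤ W x₀ := div_le_self (by linarith) (one_le_pow₀ (by norm_num))
      have h4 : β * (W x₀ / 2 ^ j) ≤ β * W x₀ := by gcongr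
      simp only [integral_const, probReal_univ, smul_eq_mul, one_mul]
      calc _ ≤ C * rate B ε n ^ k * ((1 + β * (W x₀ + 2 * B)) + (1 + β * W x₀)) := by
            gcongr
            linarith
        _ = _ := by rw [hD]; ring
  have hlim : Tendsto (fun k => D * (rate B ε n) ^ k) atTop (𝓝 0) := by
    simpa using (tendsto_pow_atTop_nhds_zero_of_lt_one hγ.le hγ1).const_mul D
  obtain ⟨π, hπ, hπk⟩ := exists_limit_measure (fun k => (P ^ k) x₀) _ hlim hcauchy
  refine ⟨π, hπ, ?_⟩
  have hle : ∀ k A, MeasurableSet A →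
      π A ≤ (P ^ k) x₀ A + ENNReal.ofReal (D * (rate B ε n) ^ k) ∧
      (P ^ k) x₀ A ≤ π A + ENNReal.ofReal (D * (rate B ε n) ^ k) := by
    intro k A hA
    have h0 : 0 ≤ D * (rate B ε n) ^ k := by positivity
    have h1 := abs_le.1 (hπk k A hA)
    rw [← ofReal_measureReal (μ := π), ← ofReal_measureReal (μ := (P ^ k) x₀),
      ← ENNReal.ofReal_add measureReal_nonneg h0, ← ENNReal.ofReal_add measureReal_nonneg h0]
    constructor <;> refine ENNReal.ofReal_le_ofReal ?_ <;> linarith [h1.1, h1.2]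
  -- Invariance: `P ^ (k + 1) (x₀, ·)` is close to the limit `π`, and it is also the image under `P`
  -- of `P ^ k (x₀, ·)`, hence close to the image of `π`, uniformly over sets.
  refine Measure.ext fun A hA => ?_
  rw [Measure.bind_apply hA P.aemeasurable]
  have hPA : ∀ x, P x A = ENNReal.ofReal ((P x).real A) ∧ (P x).real A ≤ 1 := by
    intro x
    by_cases hx : x ∈ E
    · have := h.prob x hx
      exact ⟨(ofReal_measureReal (measure_ne_top _ _)).symm, measureReal_le_one⟩
    · simp [h.eq_zero x hx]
  have hg : Measurable fun x => (P x).real A := (P.measurable_coe hA).ennreal_toReal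
  have hstep : ∀ k, ∫⁻ x, ENNReal.ofReal ((P x).real A) ∂((P ^ k) x₀) = (P ^ (k + 1)) x₀ A := by
    intro k
    rw [pow_add_apply, pow_one, Kernel.comp_apply' _ _ _ hA]
    exact lintegral_congr fun x => (hPA x).1.symm
  have hlimE : Tendsto (fun k => ENNReal.ofReal (D * (rate B ε n) ^ k)) atTop (𝓝 0) := by
    simpa using ENNReal.tendsto_ofReal hlim
  have hlimE' := hlimE.comp (tendsto_add_atTop_nat 1)
  simp_rw [fun x => (hPA x).1]
  have hlim2 : Tendsto (fun k => π A + ENNReal.ofReal (D * (rate B ε n) ^ (k + 1)) +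
      ENNReal.ofReal (D * (rate B ε n) ^ k)) atTop (𝓝 (π A)) := by
    simpa using (hlimE'.const_add (π A)).add hlimE
  have hlim3 : Tendsto (fun k => ∫⁻ x, ENNReal.ofReal ((P x).real A) ∂π +
      ENNReal.ofReal (D * (rate B ε n) ^ k) + ENNReal.ofReal (D * (rate B ε n) ^ (k + 1))) atTop
      (𝓝 (∫⁻ x, ENNReal.ofReal ((P x).real A) ∂π)) := by
    simpa using (hlimE.const_add (∫⁻ x, ENNReal.ofReal ((P x).real A) ∂π)).add hlimE'
  refine le_antisymm (ge_of_tendsto' hlim2 fun k => ?_) (ge_of_tendsto' hlim3 fun k => ?_)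
  · refine (lintegral_le_add_of_measure_le (fun A hA => (hle k A hA).1) hg
      (fun x => measureReal_nonneg) (fun x => (hPA x).2)).trans ?_
    rw [hstep]
    gcongr
    exact (hle (k + 1) A hA).2
  · refine (hle (k + 1) A hA).1.trans ?_
    rw [← hstep]
    gcongr
    exact lintegral_le_add_of_measure_le (fun A hA => (hle k A hA).2) hg
      (fun x => measureReal_nonneg) (fun x => (hPA x).2)

theorem invariant_ae_mem (h : Condition P E W B ε n) {π : Measure X}
    (hπ : Kernel.Invariant P π) : ∀ᵐ x ∂π, x ∈ E := by
  rw [ae_iff, ← compl_ofPred, ofPred_mem_eq, ← hπ.def,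
    Measure.bind_apply h.measurableSet.compl P.aemeasurable]
  refine lintegral_eq_zero_of_ae_eq_zero (ae_of_all _ fun x => ?_)
  by_cases hx : x ∈ E
  · exact h.absorbing x hx
  · simp [h.eq_zero x hx]

/-- The laws `P ^ k (x₀, ·)` converge setwise to any invariant probability measure. Dominated
convergence with bound `1` is used, so `W` need not be known to be integrable. -/
theorem invariant_unique (h : Condition P E W B ε n) (hB : 1 ≤ B) (hε : 0 < ε) (hε1 : ε ≤ 1)
    (hn : 1 ≤ n) {π₁ π₂ : Measure X} [IsProbabilityMeasure π₁] [IsProbabilityMeasure π₂]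
    (h₁ : Kernel.Invariant P π₁) (h₂ : Kernel.Invariant P π₂) : π₁ = π₂ := by
  obtain ⟨x₀, hx₀⟩ := h.nonempty
  have hγ := rate_pos (n := n) hB hε1
  have hγ1 := rate_lt_one hB hε hε1 hn
  have key : ∀ π : Measure X, IsProbabilityMeasure π → Kernel.Invariant P π → ∀ A,
      MeasurableSet A → Tendsto (fun k => ((P ^ k) x₀).real A) atTop (𝓝 (π.real A)) := by
    intro π _ hπ A hA
    have hE := h.invariant_ae_mem hπ
    have hmA (k) : Measurable fun y => ((P ^ k) y).real A :=
      ((P ^ k).measurable_coe hA).ennreal_toReal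
    have hi : Integrable (A.indicator fun _ => (1 : ℝ)) π := (integrable_const _).indicator hA
    have e1 (μ : Measure X) : ∫ z, A.indicator (fun _ => (1 : ℝ)) z ∂μ = μ.real A :=
      integral_indicator_one hA
    have e2 (k : ℕ) : π.real A - ((P ^ k) x₀).real A =
        ∫ x, (((P ^ k) x).real A - ((P ^ k) x₀).real A) ∂π := by
      have hb := (invariant_pow hπ k).def
      have hi' := hi
      rw [← hb] at hi'
      have e := integral_bind hi'
      have hint := integrable_integral_bind hi'
      rw [hb] at e
      simp only [e1] at e hint
      rw [integral_sub hint (integrable_const _), ← e]; simp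
    have h0 : Tendsto (fun k => ∫ x, (((P ^ k) x).real A - ((P ^ k) x₀).real A) ∂π) atTop
        (𝓝 (∫ _x, (0 : ℝ) ∂π)) := by
      refine tendsto_integral_of_dominated_convergence (fun _ => 1)
        (fun k => ((hmA k).sub_const _).aestronglyMeasurable) (integrable_const _) ?_ ?_
      · intro k
        filter_upwards [hE] with x hx
        have := h.pow_isProbabilityMeasure k x hx
        have := h.pow_isProbabilityMeasure k x₀ hx₀
        have b1 : ((P ^ k) x).real A ≤ 1 := measureReal_le_one
        have b2 : ((P ^ k) x₀).real A ≤ 1 := measureReal_le_one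
        have b3 : 0 ≤ ((P ^ k) x).real A := measureReal_nonneg
        have b4 : 0 ≤ ((P ^ k) x₀).real A := measureReal_nonneg
        rw [Real.norm_eq_abs, abs_le]
        constructor <;> linarith
      · filter_upwards [hE] with x hx
        refine squeeze_zero_norm (fun k => h.abs_real_sub_le hB hε hε1 hn k hA hx hx₀) ?_
        have := ((tendsto_pow_atTop_nhds_zero_of_lt_one hγ.le hγ1).const_mul
          ((1 + 2 * B) / (rate B ε n) ^ n)).mul_const
          ((1 + ε / (4 * B) * W x) + (1 + ε / (4 * B) * W x₀))
        simpa using this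
    simp_rw [← e2, integral_zero] at h0
    have := h0.const_sub (π.real A)
    simpa using this
  refine Measure.ext fun A hA => ?_
  have := tendsto_nhds_unique (key π₁ inferInstance h₁ A hA) (key π₂ inferInstance h₂ A hA)
  rw [← ofReal_measureReal (μ := π₁), this, ofReal_measureReal]

/-- Integrating the drift inequality directly could give `∞ ≤ ∞`. Truncating `W` at `N` makes the
quantities finite; the iterated drift is used with `k → ∞` first, which removes the term in `W x`,
and then `N → ∞`. -/
theorem invariant_lintegral_le (h : Condition P E W B ε n) (hB : 0 ≤ B) {π : Measure X}
    [IsProbabilityMeasure π] (hπ : Kernel.Invariant P π) :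
    ∫⁻ x, ENNReal.ofReal (W x) ∂π ≤ ENNReal.ofReal (2 * B) := by
  have hE := h.invariant_ae_mem hπ
  have hm := h.measurable
  have htrunc : ∀ N : ℕ, ∫⁻ x, ENNReal.ofReal (min (W x) N) ∂π ≤ ENNReal.ofReal (2 * B) := by
    intro N
    have hmN : Measurable fun x => ENNReal.ofReal (min (W x) N) :=
      (hm.min measurable_const).ennreal_ofReal
    have hle : ∀ k : ℕ, ∫⁻ x, ENNReal.ofReal (min (W x) N) ∂π ≤
        ∫⁻ x, min (ENNReal.ofReal (W x / 2 ^ k + 2 * B)) (ENNReal.ofReal N) ∂π := by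
      intro k
      conv_lhs => rw [← (invariant_pow hπ k).def]
      rw [Measure.lintegral_bind (P ^ k).aemeasurable hmN.aemeasurable]
      refine lintegral_mono_ae ?_
      filter_upwards [hE] with x hx
      have := h.pow_isProbabilityMeasure k x hx
      refine le_min ?_ ?_
      · refine (lintegral_mono fun y => ?_).trans (h.pow_drift hB k x hx)
        exact ENNReal.ofReal_le_ofReal (min_le_left _ _)
      · refine (lintegral_mono (g := fun _ => ENNReal.ofReal N) fun y => ?_).trans ?_
        · exact ENNReal.ofReal_le_ofReal (min_le_right _ _)
        · simp
    have hlim : Tendsto (fun k : ℕ =>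
        ∫⁻ x, min (ENNReal.ofReal (W x / 2 ^ k + 2 * B)) (ENNReal.ofReal N) ∂π) atTop
        (𝓝 (∫⁻ _x, min (ENNReal.ofReal (2 * B)) (ENNReal.ofReal N) ∂π)) := by
      refine tendsto_lintegral_of_dominated_convergence (fun _ => ENNReal.ofReal N) (fun k => ?_)
        (fun k => ae_of_all _ fun x => min_le_right _ _) (by simp) (ae_of_all _ fun x => ?_)
      · exact (((hm.div_const _).add_const _).ennreal_ofReal).min measurable_const
      · refine Tendsto.min (ENNReal.tendsto_ofReal ?_) tendsto_const_nhds
        have : Tendsto (fun k : ℕ => W x * (1 / 2) ^ k + 2 * B) atTop (𝓝 (W x * 0 + 2 * B)) :=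
          ((tendsto_pow_atTop_nhds_zero_of_lt_one (by norm_num) (by norm_num)).const_mul _).add_const _
        simpa [div_eq_mul_inv] using this
    refine (ge_of_tendsto' hlim hle).trans ?_
    simp
  have hlim : Tendsto (fun N : ℕ => ∫⁻ x, ENNReal.ofReal (min (W x) N) ∂π) atTop
      (𝓝 (∫⁻ x, ENNReal.ofReal (W x) ∂π)) := by
    refine lintegral_tendsto_of_tendsto_of_monotone
      (fun N => (hm.min measurable_const).ennreal_ofReal.aemeasurable)
      (ae_of_all _ fun x N M hNM => ?_) (ae_of_all _ fun x => ?_)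
    · exact ENNReal.ofReal_le_ofReal (min_le_min_left _ (by exact_mod_cast hNM))
    · refine ENNReal.tendsto_ofReal (tendsto_const_nhds.congr' ?_)
      obtain ⟨N, hN⟩ := exists_nat_ge (W x)
      filter_upwards [eventually_ge_atTop N] with M hM
      exact (min_eq_left (hN.trans (by exact_mod_cast hM))).symm
  exact le_of_tendsto' hlim htrunc

end Condition

/-- The multiplicative constant in the geometric convergence. -/
def const (B ε : ℝ) (n : ℕ) : ℝ :=
  (1 + 2 * B) / (rate B ε n) ^ n * (ε / (4 * B))⁻¹ *
    (2 + ε / (4 * B) + 2 * (ε / (4 * B)) * B)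

/-- **Harris' theorem**, with rate and constant depending only on the drift and minorization
constants. -/
theorem Condition.exists_geometric_ergodic (h : Condition P E W B ε n) (hB : 1 ≤ B) (hε : 0 < ε)
    (hε1 : ε ≤ 1) (hn : 1 ≤ n) :
    ∃ π : Measure X, IsProbabilityMeasure π ∧ Kernel.Invariant P π ∧ (∀ᵐ x ∂π, x ∈ E) ∧
      (∀ ρ : Measure X, IsProbabilityMeasure ρ → Kernel.Invariant P ρ → ρ = π) ∧
      Integrable W π ∧
      ∀ ψ : X → ℝ, Measurable ψ → (∀ z ∈ E, |ψ z| ≤ W z) → ∀ x ∈ E, ∀ k : ℕ,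
        Integrable ψ ((P ^ k) x) ∧
        |∫ z, ψ z ∂((P ^ k) x) - ∫ z, ψ z ∂π| ≤ const B ε n * W x * (rate B ε n) ^ k := by
  have hB0 : 0 ≤ B := zero_le_one.trans hB
  obtain ⟨π, hπ, hinv⟩ := h.exists_invariant hB hε hε1 hn
  have hE := h.invariant_ae_mem hinv
  have hW0 : ∀ x, 0 ≤ W x := fun x => zero_le_one.trans (h.one_le x)
  have hWle := h.invariant_lintegral_le hB0 hinv
  have hWi : Integrable W π :=
    (lintegral_ofReal_ne_top_iff_integrable h.measurable.aestronglyMeasurable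
      (ae_of_all _ hW0)).1 (hWle.trans_lt ENNReal.ofReal_lt_top).ne
  have hWint : ∫ x, W x ∂π ≤ 2 * B := by
    rw [integral_eq_lintegral_of_nonneg_ae (ae_of_all _ hW0) h.measurable.aestronglyMeasurable]
    exact ENNReal.toReal_le_of_le_ofReal (by positivity) hWle
  refine ⟨π, hπ, hinv, hE, fun ρ hρ hρi => h.invariant_unique hB hε hε1 hn hρi hinv, hWi, ?_⟩
  intro ψ hψ hψW x hx k
  have hβ0 : 0 < ε / (4 * B) := by positivity
  have hγ := rate_pos (n := n) hB hε1
  -- The weight `1 + β W` dominates `β W`, whence the oscillation constant `β⁻¹`.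
  have ho : Osc E (ε / (4 * B)) W ψ (ε / (4 * B))⁻¹ := by
    intro x hx y hy
    have h1 := abs_le.1 (hψW x hx)
    have h2 := abs_le.1 (hψW y hy)
    have h3 : |ψ x - ψ y| ≤ W x + W y := by
      rw [abs_le]; constructor <;> linarith [h1.1, h1.2, h2.1, h2.2]
    refine h3.trans ?_
    have : (ε / (4 * B))⁻¹ * ((1 + ε / (4 * B) * W x) + (1 + ε / (4 * B) * W y)) =
        2 * (ε / (4 * B))⁻¹ + (W x + W y) := by field_simp; ring
    rw [this]
    have : 0 < (ε / (4 * B))⁻¹ := by positivity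
    linarith
  have hψi : Integrable ψ π := by
    refine hWi.mono' hψ.aestronglyMeasurable ?_
    filter_upwards [hE] with z hz using hψW z hz
  refine ⟨h.integrable_of_osc hB0 hψ ho k hx, ?_⟩
  have hb := (invariant_pow hinv k).def
  have hi' := hψi
  rw [← hb] at hi'
  have e := integral_bind hi'
  have hint := integrable_integral_bind hi'
  rw [hb] at e
  have e2 : ∫ z, ψ z ∂((P ^ k) x) - ∫ z, ψ z ∂π =
      ∫ y, (∫ z, ψ z ∂((P ^ k) x) - ∫ z, ψ z ∂((P ^ k) y)) ∂π := by
    rw [integral_sub (integrable_const _) hint, ← e]; simp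
  rw [e2, ← Real.norm_eq_abs]
  set β := ε / (4 * B)
  set γ := rate B ε n
  have hd : Integrable (fun y => 1 + β * W y) π := (integrable_const _).add (hWi.const_mul β)
  refine (norm_integral_le_of_norm_le (((integrable_const (1 + β * W x)).add hd).const_mul
    ((1 + 2 * B) / γ ^ n * β⁻¹ * γ ^ k)) ?_).trans ?_
  · filter_upwards [hE] with y hy
    exact h.osc_geometric hB hε hε1 hn k (by positivity) hψ ho x hx y hy
  · simp only [Pi.add_apply]
    rw [integral_const_mul, integral_add (integrable_const _) hd,
      integral_add (integrable_const _) (hWi.const_mul β), integral_const_mul]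
    simp only [integral_const, probReal_univ, smul_eq_mul, one_mul]
    have h1 := h.one_le x
    have h2 : 1 + β * W x + (1 + β * ∫ y, W y ∂π) ≤ (2 + β + 2 * β * B) * W x := by
      have h3 : β * ∫ y, W y ∂π ≤ β * (2 * B) := by gcongr
      nlinarith [mul_nonneg hβ0.le hB0]
    calc _ ≤ (1 + 2 * B) / γ ^ n * β⁻¹ * γ ^ k * ((2 + β + 2 * β * B) * W x) := by gcongr
      _ = _ := by rw [const]; ring

end Harris

/-! ### The flow, the cumulated rate and the law of the post-jump location. -/

namespace PDMP

variable {E : Set ℝ} {lam f : ℝ → ℝ} {φ : ℝ → ℝ → ℝ}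

namespace Assumptions

theorem mem_of_le (h : Assumptions E lam f φ) {x y : ℝ} (hx : x ∈ E) (hxy : x ≤ y) : y ∈ E := by
  rcases h.state_space with h | h <;> rw [h] at hx ⊢
  · exact le_trans hx hxy
  · exact lt_of_lt_of_le hx hxy

theorem nonneg (h : Assumptions E lam f φ) {x : ℝ} (hx : x ∈ E) : 0 ≤ x := by
  rcases h.state_space with h | h <;> rw [h] at hx
  · exact hx
  · exact le_of_lt hx

theorem mem_of_pos (h : Assumptions E lam f φ) {x : ℝ} (hx : 0 < x) : x ∈ E := by
  rcases h.state_space with h | h <;> rw [h]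
  · exact hx.le
  · exact hx

theorem jump_mem (h : Assumptions E lam f φ) {x : ℝ} (hx : x ∈ E) : f x ∈ E :=
  h.jump_bijOn.mapsTo hx

theorem le_flow (h : Assumptions E lam f φ) {x t : ℝ} (hx : x ∈ E) (ht : 0 ≤ t) : x ≤ φ x t :=
  (h.flow_bijOn x hx).mapsTo ht

theorem contDiffOn_flow (h : Assumptions E lam f φ) {x : ℝ} (hx : x ∈ E) :
    ContDiffOn ℝ 1 (φ x) (Ici 0) := by
  have h1 : ContDiffOn ℝ 1 (fun t : ℝ => ((x, t) : ℝ × ℝ)) (Ici 0) :=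
    (contDiff_const.prodMk contDiff_id).contDiffOn
  exact h.flow_contDiffOn.comp h1 fun t ht => ⟨hx, ht⟩

/-- A continuous injection of an interval is strictly monotone, and a decreasing one is excluded
because the orbit stays above its starting point. -/
theorem strictMonoOn_flow (h : Assumptions E lam f φ) {x : ℝ} (hx : x ∈ E) :
    StrictMonoOn (φ x) (Ici 0) := by
  intro s hs t ht hst
  have hsub : Icc 0 t ⊆ Ici (0 : ℝ) := Icc_subset_Ici_self
  have ht0 : (0 : ℝ) < t := lt_of_le_of_lt hs hst
  rcases ContinuousOn.strictMonoOn_of_injOn_Icc' ht0.le ((h.contDiffOn_flow hx).continuousOn.mono hsub)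
    ((h.flow_bijOn x hx).injOn.mono hsub) with h1 | h1
  · exact h1 ⟨hs, hst.le⟩ ⟨ht0.le, le_rfl⟩ hst
  · have h2 := h1 ⟨le_rfl, ht0.le⟩ ⟨ht0.le, le_rfl⟩ ht0
    rw [h.flow_zero x hx] at h2
    exact absurd (h.le_flow hx ht0.le) (not_le.2 h2)

theorem contDiffOn_postFlow (h : Assumptions E lam f φ) {x : ℝ} (hx : x ∈ E) :
    ContDiffOn ℝ 1 (fun t => f (φ x t)) (Ici 0) :=
  h.jump_contDiffOn.comp (h.contDiffOn_flow hx) fun _ ht => h.flow_mem hx ht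

theorem strictMonoOn_postFlow (h : Assumptions E lam f φ) {x : ℝ} (hx : x ∈ E) :
    StrictMonoOn (fun t => f (φ x t)) (Ici 0) := fun _ hs _ ht hst =>
  h.jump_strictMonoOn (h.flow_mem hx hs) (h.flow_mem hx ht) (h.strictMonoOn_flow hx hs ht hst)

theorem jump_le_jump (h : Assumptions E lam f φ) {x y : ℝ} (hx : x ∈ E) (hy : y ∈ E) :
    f x ≤ f y ↔ x ≤ y := h.jump_strictMonoOn.le_iff_le hx hy

theorem exists_flow_eq (h : Assumptions E lam f φ) {x y : ℝ} (hx : x ∈ E) (hxy : x ≤ y) :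
    ∃ t, 0 ≤ t ∧ φ x t = y := (h.flow_bijOn x hx).surjOn hxy

theorem exists_postFlow_eq (h : Assumptions E lam f φ) {x y : ℝ} (hx : x ∈ E) (hxy : f x ≤ y) :
    ∃ t, 0 ≤ t ∧ f (φ x t) = y := by
  obtain ⟨z, hz, rfl⟩ := h.jump_bijOn.surjOn (h.mem_of_le (h.jump_mem hx) hxy)
  obtain ⟨t, ht, rfl⟩ := h.exists_flow_eq hx ((h.jump_le_jump hx hz).1 hxy)
  exact ⟨t, ht, rfl⟩

theorem le_postFlow (h : Assumptions E lam f φ) {x t : ℝ} (hx : x ∈ E) (ht : 0 ≤ t) :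
    f x ≤ f (φ x t) := (h.jump_le_jump hx (h.flow_mem hx ht)).2 (h.le_flow hx ht)

theorem hasDerivWithinAt_postFlow (h : Assumptions E lam f φ) {x t : ℝ} (hx : x ∈ E) (ht : 0 ≤ t) :
    HasDerivWithinAt (fun t => f (φ x t)) (derivWithin (fun t => f (φ x t)) (Ici 0) t) (Ici 0) t :=
  ((h.contDiffOn_postFlow hx).differentiableOn one_ne_zero t ht).hasDerivWithinAt

theorem derivWithin_postFlow_pos (h : Assumptions E lam f φ) {x t : ℝ} (hx : x ∈ E) (ht : 0 ≤ t) :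
    0 < derivWithin (fun t => f (φ x t)) (Ici 0) t := by
  have h1 : HasDerivWithinAt (φ x) (derivWithin (φ x) (Ici 0) t) (Ici 0) t :=
    ((h.contDiffOn_flow hx).differentiableOn one_ne_zero t ht).hasDerivWithinAt
  have h2 : HasDerivWithinAt f (derivWithin f E (φ x t)) E (φ x t) :=
    (h.jump_contDiffOn.differentiableOn one_ne_zero _ (h.flow_mem hx ht)).hasDerivWithinAt
  have h3 := (h2.comp t h1 fun s hs => h.flow_mem hx hs).derivWithin
    (uniqueDiffOn_Ici 0 t ht)
  have h4 : derivWithin (fun t => f (φ x t)) (Ici 0) t ≠ 0 := by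
    have : (fun t => f (φ x t)) = f ∘ φ x := rfl
    rw [this, h3]
    exact mul_ne_zero (h.jump_deriv_ne _ (h.flow_mem hx ht)) (h.flow_deriv_ne x hx t ht)
  exact lt_of_le_of_ne (h.strictMonoOn_postFlow hx).monotoneOn.derivWithin_nonneg h4.symm

theorem gFun_postFlow (h : Assumptions E lam f φ) {x t : ℝ} (hx : x ∈ E) (ht : 0 ≤ t) :
    gFun f φ x (f (φ x t)) = (derivWithin (fun t => f (φ x t)) (Ici 0) t)⁻¹ := by
  have : Function.invFunOn (fun t => f (φ x t)) (Ici 0) (f (φ x t)) = t :=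
    (h.strictMonoOn_postFlow hx).injOn.leftInvOn_invFunOn ht
  rw [gFun, this]

theorem invFunOn_jump (h : Assumptions E lam f φ) {x : ℝ} (hx : x ∈ E) :
    Function.invFunOn f E (f x) = x := h.jump_bijOn.injOn.leftInvOn_invFunOn hx

theorem invFunOn_mem (h : Assumptions E lam f φ) {y : ℝ} (hy : y ∈ E) :
    Function.invFunOn f E y ∈ E := Function.invFunOn_mem (h.jump_bijOn.surjOn hy)

theorem jump_invFunOn (h : Assumptions E lam f φ) {y : ℝ} (hy : y ∈ E) :
    f (Function.invFunOn f E y) = y := Function.invFunOn_eq (h.jump_bijOn.surjOn hy)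

theorem tendsto_postFlow (h : Assumptions E lam f φ) {x : ℝ} (hx : x ∈ E) :
    Tendsto (fun t => f (φ x t)) atTop atTop := by
  refine tendsto_atTop.2 fun N => ?_
  obtain ⟨t, ht, e⟩ := h.exists_postFlow_eq hx (le_max_left (f x) N)
  filter_upwards [eventually_ge_atTop t] with s hs
  refine (le_max_right (f x) N).trans (e ▸ ?_)
  exact (h.strictMonoOn_postFlow hx).monotoneOn ht (le_trans ht hs) hs

theorem measurable_jump_indicator (h : Assumptions E lam f φ) : Measurable (E.indicator f) :=
  measurable_indicator_of_restrict h.measurableSet h.jump_measurable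

/-! ### The cumulated rate -/

/-- The flow at negative times is arbitrary; `max t 0` gives an integrand that is continuous on the
whole line, to which the fundamental theorem of calculus applies. -/
theorem continuous_rate (h : Assumptions E lam f φ) (hlam : ContinuousOn lam E) {x : ℝ} (hx : x ∈ E) :
    Continuous fun t => lam (φ x (max t 0)) := by
  have h1 : ContinuousOn (fun t => lam (φ x t)) (Ici 0) :=
    hlam.comp (h.contDiffOn_flow hx).continuousOn fun t ht => h.flow_mem hx ht
  exact h1.comp_continuous (continuous_id.max continuous_const) fun t => le_max_right t 0

theorem cumRate_eq {x t : ℝ} (ht : 0 ≤ t) :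
    cumRate lam φ x t = ∫ s in (0 : ℝ)..t, lam (φ x (max s 0)) := by
  refine intervalIntegral.integral_congr fun s hs => ?_
  rw [uIcc_of_le ht] at hs
  rw [max_eq_left hs.1]

theorem hasDerivAt_cumRate_ext (h : Assumptions E lam f φ) (hlam : ContinuousOn lam E) {x : ℝ}
    (hx : x ∈ E) (t : ℝ) :
    HasDerivAt (fun t => ∫ s in (0 : ℝ)..t, lam (φ x (max s 0))) (lam (φ x (max t 0))) t :=
  (h.continuous_rate hlam hx).integral_hasStrictDerivAt 0 t |>.hasDerivAt

theorem hasDerivAt_cumRate (h : Assumptions E lam f φ) (hlam : ContinuousOn lam E) {x t : ℝ}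
    (hx : x ∈ E) (ht : 0 < t) : HasDerivAt (cumRate lam φ x) (lam (φ x t)) t := by
  have h1 := h.hasDerivAt_cumRate_ext hlam hx t
  rw [max_eq_left ht.le] at h1
  refine h1.congr_of_eventuallyEq ?_
  filter_upwards [Ioi_mem_nhds ht] with s hs using cumRate_eq (le_of_lt hs)

theorem continuousOn_cumRate (h : Assumptions E lam f φ) (hlam : ContinuousOn lam E) {x : ℝ}
    (hx : x ∈ E) : ContinuousOn (cumRate lam φ x) (Ici 0) := by
  have h1 : Continuous fun t => ∫ s in (0 : ℝ)..t, lam (φ x (max s 0)) :=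
    continuous_iff_continuousAt.2 fun t => (h.hasDerivAt_cumRate_ext hlam hx t).continuousAt
  exact h1.continuousOn.congr fun t ht => cumRate_eq ht

theorem cumRate_zero (x : ℝ) : cumRate lam φ x 0 = 0 := by simp [cumRate]

theorem monotoneOn_cumRate (h : Assumptions E lam f φ) (hlam : ContinuousOn lam E) {x : ℝ}
    (hx : x ∈ E) : MonotoneOn (cumRate lam φ x) (Ici 0) := by
  refine monotoneOn_of_deriv_nonneg (convex_Ici 0) (h.continuousOn_cumRate hlam hx) ?_ ?_
  · rw [interior_Ici]
    exact fun t ht => (h.hasDerivAt_cumRate hlam hx ht).differentiableAt.differentiableWithinAt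
  · rw [interior_Ici]
    intro t ht
    rw [(h.hasDerivAt_cumRate hlam hx ht).deriv]
    exact h.rate_nonneg _ (h.flow_mem hx (le_of_lt ht))

theorem cumRate_nonneg (h : Assumptions E lam f φ) (hlam : ContinuousOn lam E) {x t : ℝ}
    (hx : x ∈ E) (ht : 0 ≤ t) : 0 ≤ cumRate lam φ x t := by
  have := h.monotoneOn_cumRate hlam hx (mem_Ici.2 le_rfl) ht ht
  rwa [cumRate_zero] at this

theorem cumRate_add (h : Assumptions E lam f φ) (hlam : ContinuousOn lam E) {x s t : ℝ}
    (hx : x ∈ E) (hs : 0 ≤ s) (ht : 0 ≤ t) :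
    cumRate lam φ x (t + s) = cumRate lam φ x s + cumRate lam φ (φ x s) t := by
  have hc := h.continuous_rate hlam hx
  rw [cumRate_eq (add_nonneg ht hs), cumRate_eq hs,
    ← intervalIntegral.integral_add_adjacent_intervals (b := s) (hc.intervalIntegrable _ _)
      (hc.intervalIntegrable _ _)]
  congr 1
  have := intervalIntegral.integral_comp_add_right (a := 0) (b := t)
    (fun u => lam (φ x (max u 0))) s
  rw [zero_add] at this
  rw [← this]
  refine intervalIntegral.integral_congr fun u hu => ?_
  rw [uIcc_of_le ht] at hu
  rw [max_eq_left (add_nonneg hu.1 hs), h.flow_add x hx s hs u hu.1]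

/-- The integrand has the primitive `-exp (-c Λ) / c`. The case `c = 1` gives the survival function
of the jump time, and `c = 1 - κ ^ (b + 1)` an exponential moment of `Λ(x, T₁)`. -/
theorem lintegral_exp_cumRate (h : Assumptions E lam f φ) (hlam : ContinuousOn lam E) {x : ℝ}
    (hx : x ∈ E) (htop : Tendsto (cumRate lam φ x) atTop atTop) {c : ℝ} (hc : 0 < c) {t₀ : ℝ}
    (ht₀ : 0 ≤ t₀) :
    ∫⁻ t in Ici t₀, ENNReal.ofReal (lam (φ x t) * Real.exp (-(c * cumRate lam φ x t))) =
      ENNReal.ofReal (Real.exp (-(c * cumRate lam φ x t₀)) / c) := by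
  have hpos : ∀ t ∈ Ioi t₀, 0 < t := fun t ht => lt_of_le_of_lt ht₀ ht
  have hcont : ContinuousWithinAt (fun t => -(Real.exp (-(c * cumRate lam φ x t)) / c)) (Ici t₀) t₀ := by
    have := ((h.continuousOn_cumRate hlam hx).mono (Ici_subset_Ici.2 ht₀)) t₀ self_mem_Ici
    exact (((this.const_mul c).neg.rexp).div_const c).neg
  have hder : ∀ t ∈ Ioi t₀, HasDerivAt (fun t => -(Real.exp (-(c * cumRate lam φ x t)) / c))
      (lam (φ x t) * Real.exp (-(c * cumRate lam φ x t))) t := by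
    intro t ht
    have := ((((h.hasDerivAt_cumRate hlam hx (hpos t ht)).const_mul c).neg.exp).div_const c).neg
    exact this.congr_deriv (by simp only [Pi.neg_apply]; field_simp)
  have hnn : ∀ t ∈ Ioi t₀, 0 ≤ lam (φ x t) * Real.exp (-(c * cumRate lam φ x t)) := fun t ht =>
    mul_nonneg (h.rate_nonneg _ (h.flow_mem hx (hpos t ht).le)) (Real.exp_pos _).le
  have hlim : Tendsto (fun t => -(Real.exp (-(c * cumRate lam φ x t)) / c)) atTop (𝓝 0) := by
    have := ((Real.tendsto_exp_neg_atTop_nhds_zero.comp (htop.const_mul_atTop hc)).div_const c).neg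
    simpa using this
  have h1 := integrableOn_Ioi_deriv_of_nonneg hcont hder hnn hlim
  have h2 := integral_Ioi_of_hasDerivAt_of_nonneg hcont hder hnn hlim
  rw [Measure.restrict_congr_set Ioi_ae_eq_Ici.symm, ← ofReal_integral_eq_lintegral_ofReal h1
    ((ae_restrict_iff' measurableSet_Ioi).2 (ae_of_all _ hnn)), h2]
  simp

theorem lintegral_postJumpLaw (h : Assumptions E lam f φ) {x : ℝ} (hx : x ∈ E)
    {G : ℝ → ENNReal} (hG : Measurable G) :
    ∫⁻ z, G z ∂(postJumpLaw E lam f φ x) =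
      ∫⁻ t in Ici 0, ENNReal.ofReal (lam (φ x t) * Real.exp (-cumRate lam φ x t)) *
        G (f (φ x t)) := by
  have hd : AEMeasurable (fun t => ENNReal.ofReal (lam (φ x t) * Real.exp (-cumRate lam φ x t)))
      (volume.restrict (Ici 0)) := by
    refine (aemeasurable_indicator_iff measurableSet_Ici).1 ?_
    refine (h.measurable_jumpTimeDensity.comp
      (measurable_prodMk_left (x := x))).aemeasurable.congr (ae_of_all _ fun t => ?_)
    by_cases ht : 0 ≤ t <;> simp [indicator, hx, ht]
  have hp : AEMeasurable (fun t => f (φ x t)) (volume.restrict (Ici 0)) :=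
    (aemeasurable_indicator_iff measurableSet_Ici).1 (h.measurable_postJump hx).aemeasurable
  rw [postJumpLaw, if_pos hx, lintegral_map' hG.aemeasurable (h.aemeasurable_postJump hx),
    jumpTimeLaw]
  exact lintegral_withDensity_eq_lintegral_mul₀ hd (hG.comp_aemeasurable hp)

theorem postJumpLaw_apply (h : Assumptions E lam f φ) {x : ℝ} (hx : x ∈ E)
    {A : Set ℝ} (hA : MeasurableSet A) :
    postJumpLaw E lam f φ x A =
      ∫⁻ t in Ici 0, ENNReal.ofReal (lam (φ x t) * Real.exp (-cumRate lam φ x t)) *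
        A.indicator 1 (f (φ x t)) := by
  rw [← lintegral_indicator_one hA, h.lintegral_postJumpLaw hx (measurable_one.indicator hA)]

theorem postJumpLaw_Ici (h : Assumptions E lam f φ) (hlam : ContinuousOn lam E) {x : ℝ}
    (hx : x ∈ E) (htop : Tendsto (cumRate lam φ x) atTop atTop) {t₀ : ℝ} (ht₀ : 0 ≤ t₀) :
    postJumpLaw E lam f φ x (Ici (f (φ x t₀))) = ENNReal.ofReal (Real.exp (-cumRate lam φ x t₀)) := by
  rw [h.postJumpLaw_apply hx measurableSet_Ici]
  have h1 := h.lintegral_exp_cumRate hlam hx htop one_pos ht₀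
  simp only [one_mul, div_one] at h1
  rw [← h1, ← lintegral_indicator measurableSet_Ici, ← lintegral_indicator measurableSet_Ici]
  refine lintegral_congr fun t => ?_
  by_cases ht : 0 ≤ t
  · have e : f (φ x t₀) ≤ f (φ x t) ↔ t₀ ≤ t := (h.strictMonoOn_postFlow hx).le_iff_le ht₀ ht
    by_cases h2 : t₀ ≤ t
    · simp [indicator, ht, h2, e.2 h2]
    · simp [indicator, h2, e]
  · have h2 : ¬ t₀ ≤ t := fun h2 => ht (ht₀.trans h2)
    simp [indicator, ht, h2]

theorem postJumpLaw_ae_ge (h : Assumptions E lam f φ) {x : ℝ} (hx : x ∈ E) :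
    ∀ᵐ z ∂(postJumpLaw E lam f φ x), f x ≤ z := by
  rw [ae_iff]
  simp only [not_le]
  change postJumpLaw E lam f φ x (Iio (f x)) = 0
  rw [h.postJumpLaw_apply hx measurableSet_Iio]
  rw [setLIntegral_congr_fun (g := fun _ => 0) measurableSet_Ici, lintegral_zero]
  intro t ht
  simp [indicator, not_lt.2 (h.le_postFlow hx ht)]

theorem postJumpLaw_isProbabilityMeasure (h : Assumptions E lam f φ) (hlam : ContinuousOn lam E)
    {x : ℝ} (hx : x ∈ E) (htop : Tendsto (cumRate lam φ x) atTop atTop) :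
    IsProbabilityMeasure (postJumpLaw E lam f φ x) := by
  constructor
  have h1 := h.postJumpLaw_Ici hlam hx htop le_rfl
  rw [cumRate_zero, neg_zero, Real.exp_zero, ENNReal.ofReal_one, h.flow_zero x hx] at h1
  rw [← h1]
  refine measure_congr ?_
  filter_upwards [h.postJumpLaw_ae_ge hx] with z hz
  exact propext ⟨fun _ => hz, fun _ => trivial⟩

/-- Starting from `x`, the process reaches `φ x τ` before jumping with probability
`exp (- Λ(x, τ))`. -/
theorem smul_postJumpLaw_flow_le (h : Assumptions E lam f φ) (hlam : ContinuousOn lam E) {x τ : ℝ}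
    (hx : x ∈ E) (hτ : 0 ≤ τ) :
    ENNReal.ofReal (Real.exp (-cumRate lam φ x τ)) • postJumpLaw E lam f φ (φ x τ) ≤
      postJumpLaw E lam f φ x := by
  refine Measure.le_iff.2 fun A hA => ?_
  rw [Measure.smul_apply, smul_eq_mul, h.postJumpLaw_apply hx hA,
    h.postJumpLaw_apply (h.flow_mem hx hτ) hA, ← lintegral_const_mul' _ _ ENNReal.ofReal_ne_top]
  rw [← lintegral_indicator measurableSet_Ici, ← lintegral_indicator measurableSet_Ici]
  conv_rhs => rw [← lintegral_add_right_eq_self _ τ]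
  refine lintegral_mono fun t => ?_
  by_cases ht : 0 ≤ t
  · simp only [indicator, mem_Ici, ht, add_nonneg ht hτ, if_true]
    rw [h.flow_add x hx τ hτ t ht, h.cumRate_add hlam hx hτ ht, neg_add, Real.exp_add, ← mul_assoc,
      ← ENNReal.ofReal_mul (Real.exp_pos _).le]
    refine le_of_eq ?_
    congr 2
    ring
  · simp [indicator, ht]

end Assumptions

end PDMP

/-! ### Drift and minorization estimates for the class. -/

namespace PDMP

variable {E : Set ℝ} {lam f : ℝ → ℝ} {φ : ℝ → ℝ → ℝ} {b r κ l L a : ℝ} {m M : ℝ → ℝ}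

/-- The exponent of the Lyapunov function, as a function of the post-jump location. -/
def potential (a b y : ℝ) : ℝ := a / (b + 1) * y ^ (b + 1)

theorem potential_mono (ha : 0 < a) (hb : 0 < b) {y z : ℝ} (hy : 0 ≤ y) (hyz : y ≤ z) :
    potential a b y ≤ potential a b z := by
  have : 0 ≤ a / (b + 1) := by positivity
  exact mul_le_mul_of_nonneg_left (Real.rpow_le_rpow hy hyz (by positivity)) this

theorem potential_nonneg (ha : 0 < a) (hb : 0 < b) {y : ℝ} (hy : 0 ≤ y) : 0 ≤ potential a b y := by
  unfold potential; positivity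

theorem tendsto_potential (ha : 0 < a) (hb : 0 < b) : Tendsto (potential a b) atTop atTop :=
  (tendsto_rpow_atTop (by positivity)).const_mul_atTop (by positivity)

theorem potential_add_le (ha : 0 < a) (hb : 0 < b) {y z : ℝ} (hy : 0 ≤ y) (hz : 0 ≤ z) :
    potential a b y + potential a b z ≤ potential a b (y + z) := by
  have : 0 ≤ a / (b + 1) := by positivity
  unfold potential
  rw [← mul_add]
  exact mul_le_mul_of_nonneg_left (Real.add_rpow_le_rpow_add hy hz (by linarith)) this

theorem potential_mul (hκ : 0 ≤ κ) {y : ℝ} (hy : 0 ≤ y) :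
    potential a b (κ * y) = κ ^ (b + 1) * potential a b y := by
  unfold potential
  rw [Real.mul_rpow hκ hy]
  ring

namespace MemClass

theorem jump_le (hc : MemClass E b r κ l L a m M lam f φ) (h : Assumptions E lam f φ) (hκ : 0 < κ)
    {x : ℝ} (hx : x ∈ E) : f x ≤ κ * x := by
  rcases (h.nonneg hx).eq_or_lt with h0 | h0
  · subst h0
    rw [mul_zero]
    -- The bounds on `f` are assumed at positive points only; at `0` the inequality follows by
    -- monotonicity, comparing with `ε / κ`.
    refine le_of_forall_pos_le_add fun ε hε => ?_
    have hy : 0 < ε / κ := by positivity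
    have h1 := (hc.jump_bounds _ hy).2
    have h2 := (h.jump_le_jump hx (h.mem_of_pos hy)).2 hy.le
    rw [mul_div_cancel₀ _ hκ.ne'] at h1
    linarith
  · exact (hc.jump_bounds x h0).2

/-- The derivative of `U (f (φ x u))` is `a f ^ b (f ∘ φ_x)'`, and `g_x ≥ m` bounds it by `a f ^ b /
m (f)`. This is at most the jump rate once the flow has passed `r`, so `Λ - U ∘ f ∘ φ_x` is
nondecreasing from then on. -/
theorem potential_sub_le (hc : MemClass E b r κ l L a m M lam f φ) (h : Assumptions E lam f φ)
    (ha : 0 < a) (hb : 0 < b) (hr : 0 < r) (hm : ∀ y, 0 ≤ y → 0 < m y) {x s t : ℝ} (hx : x ∈ E)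
    (hs : 0 ≤ s) (hst : s ≤ t) (hrs : r ≤ φ x s) :
    potential a b (f (φ x t)) - potential a b (f (φ x s)) ≤
      cumRate lam φ x t - cumRate lam φ x s := by
  have hsub : Ici s ⊆ Ici (0 : ℝ) := Ici_subset_Ici.2 hs
  have hder : ∀ u ∈ Ioi s, HasDerivAt
      (fun u => cumRate lam φ x u - potential a b (f (φ x u)))
      (lam (φ x u) - a * (f (φ x u)) ^ b * derivWithin (fun t => f (φ x t)) (Ici 0) u) u := by
    intro u hu
    have hu0 : 0 < u := lt_of_le_of_lt hs hu
    have h1 := (h.hasDerivWithinAt_postFlow hx hu0.le).hasDerivAt (Ici_mem_nhds hu0)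
    have h2 := (h1.rpow_const (p := b + 1) (Or.inr (by linarith))).const_mul (a / (b + 1))
    refine ((h.hasDerivAt_cumRate hc.rate_continuousOn hx hu0).sub h2).congr_deriv ?_
    rw [add_sub_cancel_right]
    field_simp
  have hF : ContinuousOn (fun u => f (φ x u)) (Ici s) :=
    (h.contDiffOn_postFlow hx).continuousOn.mono hsub
  have hmono : MonotoneOn (fun u => cumRate lam φ x u - potential a b (f (φ x u))) (Ici s) := by
    refine monotoneOn_of_deriv_nonneg (convex_Ici s) ?_ ?_ ?_
    · refine ((h.continuousOn_cumRate hc.rate_continuousOn hx).mono hsub).sub ?_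
      exact (hF.rpow_const fun u _ => Or.inr (by linarith)).const_mul _
    · rw [interior_Ici]
      exact fun u hu => (hder u hu).differentiableAt.differentiableWithinAt
    · rw [interior_Ici]
      intro u hu
      have hu0 : 0 < u := lt_of_le_of_lt hs hu
      rw [(hder u hu).deriv, sub_nonneg]
      have hru : r ≤ φ x u := hrs.trans ((h.strictMonoOn_flow hx).monotoneOn hs hu0.le (le_of_lt hu))
      have hfu := (hc.jump_bounds _ (hr.trans_le hru)).1
      have h1 := (hc.g_bounds _ hfu x hx (h.le_postFlow hx hu0.le)).1
      rw [h.gFun_postFlow hx hu0.le] at h1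
      have hmu := hm _ hfu.le
      have hd := h.derivWithin_postFlow_pos hx hu0.le
      have h2 : derivWithin (fun t => f (φ x t)) (Ici 0) u ≤ (m (f (φ x u)))⁻¹ := by
        rw [← inv_inv (derivWithin _ _ _)]
        exact inv_anti₀ hmu h1
      calc _ ≤ a * (f (φ x u)) ^ b * (m (f (φ x u)))⁻¹ := by gcongr
        _ ≤ _ := by rw [← div_eq_mul_inv]; exact hc.rate_ge _ hru
  have := hmono self_mem_Ici (mem_Ici.2 hst) hst
  simp only at this
  linarith

/-- Below `r` the rate has no lower bound, but there `f z ≤ κ z ≤ r` keeps the potential under `U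
r`; the comparison of growths takes over when the flow crosses `r`. -/
theorem potential_le (hc : MemClass E b r κ l L a m M lam f φ) (h : Assumptions E lam f φ)
    (ha : 0 < a) (hb : 0 < b) (hr : 0 < r) (hκ : 0 < κ) (hκ1 : κ < 1) (hm : ∀ y, 0 ≤ y → 0 < m y)
    {x t : ℝ} (hx : x ∈ E) (ht : 0 ≤ t) :
    potential a b (f (φ x t)) ≤
      max (potential a b (f x)) (potential a b r) + cumRate lam φ x t := by
  have hle : ∀ {z}, z ∈ E → z ≤ r → potential a b (f z) ≤ potential a b r := fun {z} hz hzr => by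
    refine potential_mono ha hb (h.nonneg (h.jump_mem hz)) ?_
    have := hc.jump_le h hκ hz
    have := h.nonneg hz
    nlinarith
  have hcum := h.cumRate_nonneg hc.rate_continuousOn hx ht
  rcases le_total (φ x t) r with h1 | h1
  · linarith [hle (h.flow_mem hx ht) h1, le_max_right (potential a b (f x)) (potential a b r)]
  · rcases le_total r x with h2 | h2
    · have := hc.potential_sub_le h ha hb hr hm hx le_rfl ht ((h.flow_zero x hx).symm ▸ h2)
      rw [h.flow_zero x hx, Assumptions.cumRate_zero] at this
      linarith [le_max_left (potential a b (f x)) (potential a b r)]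
    · obtain ⟨s, hs, e⟩ := h.exists_flow_eq hx h2
      have hst : s ≤ t := (h.strictMonoOn_flow hx).le_iff_le hs ht |>.1 (e ▸ h1)
      have := hc.potential_sub_le h ha hb hr hm hx hs hst e.ge
      have h3 := h.cumRate_nonneg hc.rate_continuousOn hx hs
      have h4 := hle (h.flow_mem hx hs) e.le
      linarith [le_max_right (potential a b (f x)) (potential a b r)]

theorem tendsto_cumRate (hc : MemClass E b r κ l L a m M lam f φ) (h : Assumptions E lam f φ)
    (ha : 0 < a) (hb : 0 < b) (hr : 0 < r) (hκ : 0 < κ) (hκ1 : κ < 1) (hm : ∀ y, 0 ≤ y → 0 < m y)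
    {x : ℝ} (hx : x ∈ E) : Tendsto (cumRate lam φ x) atTop atTop := by
  have h1 : Tendsto (fun t => potential a b (f (φ x t)) -
      max (potential a b (f x)) (potential a b r)) atTop atTop :=
    tendsto_atTop_add_const_right _ _ ((tendsto_potential ha hb).comp (h.tendsto_postFlow hx))
  refine tendsto_atTop_mono' _ ?_ h1
  filter_upwards [eventually_ge_atTop 0] with t ht
  have := hc.potential_le h ha hb hr hκ hκ1 hm hx ht
  linarith

/-- The drift inequality, in multiplicative form. -/
theorem lintegral_lyapunov_le (hc : MemClass E b r κ l L a m M lam f φ) (h : Assumptions E lam f φ)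
    (ha : 0 < a) (hb : 0 < b) (hr : 0 < r) (hκ : 0 < κ) (hκ1 : κ < 1) (hm : ∀ y, 0 ≤ y → 0 < m y)
    {W : ℝ → ℝ} (hWm : Measurable W) (hW : ∀ z ∈ E, W z = lyapunov a b f z) {x : ℝ} (hx : x ∈ E) :
    ∫⁻ z, ENNReal.ofReal (W z) ∂(postJumpLaw E lam f φ x) ≤
      ENNReal.ofReal (Real.exp (κ ^ (b + 1) * max (potential a b (f x)) (potential a b r)) /
        (1 - κ ^ (b + 1))) := by
  have hq0 : 0 < κ ^ (b + 1) := Real.rpow_pos_of_pos hκ _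
  have hq1 : κ ^ (b + 1) < 1 := Real.rpow_lt_one hκ.le hκ1 (by linarith)
  set q := κ ^ (b + 1) with hq
  set p := max (potential a b (f x)) (potential a b r)
  have htop := hc.tendsto_cumRate h ha hb hr hκ hκ1 hm hx
  -- This is the identity `𝔼 exp (q Λ(x, T₁)) = 1 / (1 - q)` for a standard exponential variable.
  have h1 := h.lintegral_exp_cumRate hc.rate_continuousOn hx htop (sub_pos.2 hq1) le_rfl
  rw [Assumptions.cumRate_zero, mul_zero, neg_zero, Real.exp_zero] at h1
  rw [h.lintegral_postJumpLaw hx hWm.ennreal_ofReal]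
  calc _ ≤ ∫⁻ t in Ici 0, ENNReal.ofReal (Real.exp (q * p)) *
        ENNReal.ofReal (lam (φ x t) * Real.exp (-((1 - q) * cumRate lam φ x t))) := by
        refine setLIntegral_mono' measurableSet_Ici fun t ht => ?_
        have hF := h.jump_mem (h.flow_mem hx ht)
        have hlam := h.rate_nonneg _ (h.flow_mem hx ht)
        rw [hW _ hF, ← ENNReal.ofReal_mul (mul_nonneg hlam (Real.exp_pos _).le),
          ← ENNReal.ofReal_mul (Real.exp_pos _).le]
        refine ENNReal.ofReal_le_ofReal ?_
        -- The second `f`, the one inside `𝕍`, contributes the contraction: `f ≤ κ` times the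
        -- identity, and `U` is homogeneous of degree `b + 1`.
        have h2 : potential a b (f (f (φ x t))) ≤ q * (p + cumRate lam φ x t) := by
          calc _ ≤ potential a b (κ * f (φ x t)) :=
                potential_mono ha hb (h.nonneg (h.jump_mem hF)) (hc.jump_le h hκ hF)
            _ = q * potential a b (f (φ x t)) := potential_mul hκ.le (h.nonneg hF)
            _ ≤ _ := by
                gcongr
                exact hc.potential_le h ha hb hr hκ hκ1 hm hx ht
        have h3 : lyapunov a b f (f (φ x t)) ≤ Real.exp (q * (p + cumRate lam φ x t)) :=
          Real.exp_le_exp.2 h2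
        calc _ ≤ lam (φ x t) * Real.exp (-cumRate lam φ x t) *
              Real.exp (q * (p + cumRate lam φ x t)) := by gcongr
          _ = lam (φ x t) * Real.exp (-cumRate lam φ x t + q * (p + cumRate lam φ x t)) := by
              rw [mul_assoc, ← Real.exp_add]
          _ = lam (φ x t) * (Real.exp (q * p) * Real.exp (-((1 - q) * cumRate lam φ x t))) := by
              rw [← Real.exp_add]; congr 2; ring
          _ = _ := by ring
    _ = _ := by
        rw [lintegral_const_mul' _ _ ENNReal.ofReal_ne_top, h1,
          ← ENNReal.ofReal_mul (Real.exp_pos _).le, mul_one_div]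

/-- The change of variables `s = f (φ x t)` turns `Λ(x, τ)` into an integral of `g_x(s) lam (f⁻¹ s)`
over a part of `(0, f r)`, where `g_x ≤ M`; the integral bound of the class then applies. -/
theorem cumRate_le (hc : MemClass E b r κ l L a m M lam f φ) (h : Assumptions E lam f φ)
    (hL : 0 < L) {x τ : ℝ} (hx : x ∈ E) (hτ : 0 ≤ τ) (e : φ x τ = r) : cumRate lam φ x τ ≤ L := by
  have hder : ∀ t ∈ Ioo 0 τ, HasDerivWithinAt (fun t => f (φ x t))
      (derivWithin (fun t => f (φ x t)) (Ici 0) t) (Ioo 0 τ) t := fun t ht =>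
    (h.hasDerivWithinAt_postFlow hx ht.1.le).mono fun s hs => hs.1.le
  have hinj : InjOn (fun t => f (φ x t)) (Ioo 0 τ) :=
    (h.strictMonoOn_postFlow hx).injOn.mono fun s hs => hs.1.le
  have hch := lintegral_image_eq_lintegral_abs_deriv_mul measurableSet_Ioo hder hinj
    (fun s => ENNReal.ofReal (gFun f φ x s * lam (Function.invFunOn f E s)))
  have h1 : ∫⁻ t in Ioo 0 τ, ENNReal.ofReal (lam (φ x t)) ≤ ENNReal.ofReal L := by
    calc ∫⁻ t in Ioo 0 τ, ENNReal.ofReal (lam (φ x t))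
        = ∫⁻ s in (fun t => f (φ x t)) '' Ioo 0 τ,
            ENNReal.ofReal (gFun f φ x s * lam (Function.invFunOn f E s)) := by
          rw [hch]
          refine setLIntegral_congr_fun measurableSet_Ioo fun t ht => ?_
          have hd := h.derivWithin_postFlow_pos hx ht.1.le
          rw [← ENNReal.ofReal_mul (abs_nonneg _), h.gFun_postFlow hx ht.1.le,
            h.invFunOn_jump (h.flow_mem hx ht.1.le), abs_of_pos hd, mul_inv_cancel_left₀ hd.ne']
      _ ≤ ∫⁻ s in Ioo (f x) (f r),
            ENNReal.ofReal (gFun f φ x s * lam (Function.invFunOn f E s)) := by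
          refine lintegral_mono_set ?_
          rintro _ ⟨t, ht, rfl⟩
          have h1 := h.strictMonoOn_postFlow hx (mem_Ici.2 le_rfl) (mem_Ici.2 ht.1.le) ht.1
          have h2 := h.strictMonoOn_postFlow hx (mem_Ici.2 ht.1.le) (mem_Ici.2 hτ) ht.2
          simp only [h.flow_zero x hx, e] at h1 h2
          exact ⟨h1, h2⟩
      _ ≤ ∫⁻ s in Ioo (f x) (f r), ENNReal.ofReal (M s * lam (Function.invFunOn f E s)) := by
          refine setLIntegral_mono' measurableSet_Ioo fun s hs => ENNReal.ofReal_le_ofReal ?_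
          have hs0 : 0 < s := (h.nonneg (h.jump_mem hx)).trans_lt hs.1
          exact mul_le_mul_of_nonneg_right (hc.g_bounds s hs0 x hx hs.1.le).2
            (h.rate_nonneg _ (h.invFunOn_mem (h.mem_of_pos hs0)))
      _ ≤ ∫⁻ s in Ioo 0 (f r), ENNReal.ofReal (M s * lam (Function.invFunOn f E s)) :=
          lintegral_mono_set (Ioo_subset_Ioo_left (h.nonneg (h.jump_mem hx)))
      _ ≤ _ := hc.integral_le
  have hcont : ContinuousOn (fun t => lam (φ x t)) (Ici 0) :=
    hc.rate_continuousOn.comp (h.contDiffOn_flow hx).continuousOn fun t ht => h.flow_mem hx ht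
  rw [cumRate, intervalIntegral.integral_of_le hτ, integral_Ioc_eq_integral_Ioo,
    integral_eq_lintegral_of_nonneg_ae]
  · exact ENNReal.toReal_le_of_le_ofReal hL.le h1
  · exact (ae_restrict_iff' measurableSet_Ioo).2 (ae_of_all _ fun t ht =>
      h.rate_nonneg _ (h.flow_mem hx ht.1.le))
  · exact (hcont.mono fun t ht => ht.1.le).aestronglyMeasurable measurableSet_Ioo

theorem smul_postJumpLaw_le (hc : MemClass E b r κ l L a m M lam f φ) (h : Assumptions E lam f φ)
    (hL : 0 < L) {x : ℝ} (hx : x ∈ E) (hxr : x ≤ r) :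
    ENNReal.ofReal (Real.exp (-L)) • postJumpLaw E lam f φ r ≤ postJumpLaw E lam f φ x := by
  obtain ⟨τ, hτ, e⟩ := h.exists_flow_eq hx hxr
  refine le_trans ?_ (h.smul_postJumpLaw_flow_le hc.rate_continuousOn hx hτ)
  rw [e]
  refine Measure.le_iff.2 fun A _ => ?_
  rw [Measure.smul_apply, Measure.smul_apply, smul_eq_mul, smul_eq_mul]
  gcongr
  exact hc.cumRate_le h hL hx hτ e

/-- When `f (φ x s)` reaches `c ≥ κ r ≥ f r`, the flow is already above `r`. Up to level `c + η` the
cumulated rate then grows by at least `U (c + η) - U c ≥ U η`, by superadditivity; the probability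
of overshooting is bounded independently of `c`. -/
theorem le_postJumpLaw_Iic (hc : MemClass E b r κ l L a m M lam f φ) (h : Assumptions E lam f φ)
    (ha : 0 < a) (hb : 0 < b) (hr : 0 < r) (hκ : 0 < κ) (hκ1 : κ < 1) (hm : ∀ y, 0 ≤ y → 0 < m y)
    {x c η : ℝ} (hx : x ∈ E) (hxc : f x ≤ c) (hcr : κ * r ≤ c) (hη : 0 ≤ η) :
    ENNReal.ofReal (1 - Real.exp (-potential a b η)) ≤ postJumpLaw E lam f φ x (Iic (c + η)) := by
  have hc0 : 0 ≤ c := le_trans (by positivity) hcr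
  have htop := hc.tendsto_cumRate h ha hb hr hκ hκ1 hm hx
  have := h.postJumpLaw_isProbabilityMeasure hc.rate_continuousOn hx htop
  obtain ⟨s, hs, es⟩ := h.exists_postFlow_eq hx hxc
  obtain ⟨t, ht, et⟩ := h.exists_postFlow_eq hx (hxc.trans (le_add_of_nonneg_right hη : c ≤ c + η))
  have hst : s ≤ t := by
    refine (h.strictMonoOn_postFlow hx).le_iff_le hs ht |>.1 ?_
    simp only [es, et]; linarith
  have hrE := h.mem_of_pos hr
  have hrs : r ≤ φ x s := by
    refine (h.jump_le_jump hrE (h.flow_mem hx hs)).1 ?_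
    rw [es]
    exact (hc.jump_bounds r hr).2.trans hcr
  have h1 := hc.potential_sub_le h ha hb hr hm hx hs hst hrs
  rw [es, et] at h1
  have h2 := potential_add_le ha hb hc0 hη
  have h3 := h.cumRate_nonneg hc.rate_continuousOn hx hs
  have h4 : postJumpLaw E lam f φ x (Ioi (c + η)) ≤ ENNReal.ofReal (Real.exp (-potential a b η)) := by
    refine (measure_mono Ioi_subset_Ici_self).trans ?_
    rw [← et, h.postJumpLaw_Ici hc.rate_continuousOn hx htop ht]
    refine ENNReal.ofReal_le_ofReal (Real.exp_le_exp.2 ?_)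
    linarith
  have h5 := prob_add_prob_compl (μ := postJumpLaw E lam f φ x) (measurableSet_Iic (a := c + η))
  rw [compl_Iic] at h5
  rw [ENNReal.ofReal_sub _ (Real.exp_pos _).le, ENNReal.ofReal_one, tsub_le_iff_right, ← h5]
  gcongr

end MemClass

end PDMP

/-! ### Verification of the Harris condition with uniform constants. -/

namespace PDMP

variable {E : Set ℝ} {lam f : ℝ → ℝ} {φ : ℝ → ℝ → ℝ} {b r κ l L a : ℝ} {m M : ℝ → ℝ}

theorem postJumpKernel_apply (h : Assumptions E lam f φ) (x : ℝ) :
    postJumpKernel h x = postJumpLaw E lam f φ x := rfl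

/-- The Lyapunov function on `E`, extended by `1`. -/
def weight (E : Set ℝ) (a b : ℝ) (f : ℝ → ℝ) (x : ℝ) : ℝ :=
  E.indicator (fun z => lyapunov a b f z - 1) x + 1

theorem weight_eq {x : ℝ} (hx : x ∈ E) : weight E a b f x = lyapunov a b f x := by
  simp [weight, hx]

theorem Assumptions.measurable_weight (h : Assumptions E lam f φ) : Measurable (weight E a b f) := by
  refine (measurable_indicator_of_restrict h.measurableSet ?_).add_const 1
  have h1 := h.jump_measurable
  have : E.domRestrict (fun z => lyapunov a b f z - 1) =
      fun z => Real.exp (a / (b + 1) * (E.domRestrict f z) ^ (b + 1)) - 1 := rfl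
  rw [this]
  exact (((h1.pow_const _).const_mul _).exp).sub_const _

theorem Assumptions.one_le_weight (h : Assumptions E lam f φ) (ha : 0 < a) (hb : 0 < b) (x : ℝ) :
    1 ≤ weight E a b f x := by
  by_cases hx : x ∈ E
  · rw [weight_eq hx]
    exact Real.one_le_exp (potential_nonneg ha hb (h.nonneg (h.jump_mem hx)))
  · simp [weight, hx]

theorem Assumptions.postJumpLaw_ae_mem (h : Assumptions E lam f φ) {x : ℝ} (hx : x ∈ E) :
    ∀ᵐ z ∂(postJumpLaw E lam f φ x), z ∈ E := by
  filter_upwards [h.postJumpLaw_ae_ge hx] with z hz using h.mem_of_le (h.jump_mem hx) hz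

/-- Descent below `r`. With `η = r (1 - κ) / 2`, a location at most `c + η` is sent by `f` below `c
- κ η` when `c ≥ κ r + κ η`, so each successful jump lowers the level of `f` by `κ η`. At level `κ
r`, one more success lands below `κ r + η ≤ r`. -/
theorem MemClass.le_postJumpKernel_pow_Iic (hc : MemClass E b r κ l L a m M lam f φ)
    (h : Assumptions E lam f φ) (ha : 0 < a) (hb : 0 < b) (hr : 0 < r) (hκ : 0 < κ) (hκ1 : κ < 1)
    (hm : ∀ y, 0 ≤ y → 0 < m y) (N : ℕ) : ∀ x ∈ E, f x ≤ κ * r + N * (κ * (r * (1 - κ) / 2)) →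
    ENNReal.ofReal (1 - Real.exp (-potential a b (r * (1 - κ) / 2))) ^ (N + 1) ≤
      (postJumpKernel h ^ (N + 1)) x (Iic r) := by
  have hη : 0 ≤ r * (1 - κ) / 2 := by
    have := sub_pos.2 hκ1
    positivity
  set η := r * (1 - κ) / 2 with hηd
  induction N with
  | zero =>
    intro x hx hfx
    rw [zero_add, pow_one, pow_one]
    refine (hc.le_postJumpLaw_Iic h ha hb hr hκ hκ1 hm hx (c := κ * r) (by simpa using hfx) le_rfl
      hη).trans (measure_mono (Iic_subset_Iic.2 ?_))
    rw [hηd]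
    nlinarith
  | succ N ih =>
    intro x hx hfx
    rw [Harris.pow_succ_apply, Kernel.comp_apply' _ _ _ measurableSet_Iic]
    set c := κ * r + (N + 1 : ℕ) * (κ * η) with hcd
    have h1 := hc.le_postJumpLaw_Iic h ha hb hr hκ hκ1 hm hx hfx
      (le_add_of_nonneg_right (by positivity)) hη
    calc _ ≤ ENNReal.ofReal (1 - Real.exp (-potential a b η)) ^ (N + 1) *
          postJumpLaw E lam f φ x (Iic (c + η)) := by
          rw [pow_succ]
          gcongr
      _ = ∫⁻ _z in Iic (c + η), ENNReal.ofReal (1 - Real.exp (-potential a b η)) ^ (N + 1)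
            ∂(postJumpLaw E lam f φ x) := by rw [setLIntegral_const]
      _ ≤ ∫⁻ z in Iic (c + η), (postJumpKernel h ^ (N + 1)) z (Iic r)
            ∂(postJumpLaw E lam f φ x) := by
          refine lintegral_mono_ae ?_
          filter_upwards [ae_restrict_of_ae (h.postJumpLaw_ae_mem hx),
            ae_restrict_mem measurableSet_Iic] with z hz hzc
          refine ih z hz ((hc.jump_le h hκ hz).trans ?_)
          have h2 : κ * z ≤ κ * (c + η) := by gcongr; exact hzc
          refine h2.trans ?_
          have h3 : κ * (κ * r + η) = κ * r - κ * η := by rw [hηd]; ring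
          have h4 : κ * ((N + 1) * (κ * η)) ≤ 1 * ((N + 1) * (κ * η)) := by gcongr
          rw [hcd]
          push_cast
          linarith
      _ ≤ _ := setLIntegral_le_lintegral _ _

/-- Since `q < 1`, `exp (q p) / (1 - q)` is at most `exp p / 2` as soon as `exp ((1 - q) p) ≥ 2 / (1
- q)`; this fixes the threshold `p₀`, and `B` absorbs the values below it. -/
theorem exists_drift_constant {q : ℝ} (hq1 : q < 1) (hq0 : 0 < q) (u : ℝ) :
    ∃ B : ℝ, 1 ≤ B ∧ ∀ p, Real.exp (q * max p u) / (1 - q) ≤ Real.exp p / 2 + B := by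
  have h1q := sub_pos.2 hq1
  set p₀ := max u (Real.log (2 / (1 - q)) / (1 - q))
  refine ⟨max 1 (Real.exp (q * p₀) / (1 - q)), le_max_left _ _, fun p => ?_⟩
  rcases le_or_gt (max p u) p₀ with h | h
  · have h1 : Real.exp (q * max p u) / (1 - q) ≤ Real.exp (q * p₀) / (1 - q) := by gcongr
    have := le_max_right 1 (Real.exp (q * p₀) / (1 - q))
    have := Real.exp_pos p
    linarith
  · have hu : u < max p u := (le_max_left _ _).trans_lt h
    have hp : max p u = p := max_eq_left (by
      by_contra hlt
      rw [max_eq_right (not_le.1 hlt).le] at hu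
      exact lt_irrefl _ hu)
    rw [hp] at h ⊢
    have h2 : Real.log (2 / (1 - q)) < p * (1 - q) := by
      rw [← div_lt_iff₀ h1q]; exact (le_max_right _ _).trans_lt h
    have h3 : 2 / (1 - q) ≤ Real.exp (p * (1 - q)) :=
      (Real.log_le_iff_le_exp (by positivity)).1 h2.le
    have h4 : Real.exp (q * p) / (1 - q) ≤ Real.exp p / 2 := by
      have e : Real.exp p = Real.exp (q * p) * Real.exp (p * (1 - q)) := by
        rw [← Real.exp_add]; congr 1; ring
      have h5 : Real.exp (q * p) * (2 / (1 - q)) ≤ Real.exp (q * p) * Real.exp (p * (1 - q)) := by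
        gcongr
      rw [e]
      calc _ = Real.exp (q * p) * (2 / (1 - q)) / 2 := by ring
        _ ≤ _ := by gcongr
    have := le_max_left 1 (Real.exp (q * p₀) / (1 - q))
    linarith

theorem exists_harris_constants (E : Set ℝ) (l : ℝ) (M : ℝ → ℝ) (hb : 0 < b) (hr : 0 < r)
    (hκ : 0 < κ) (hκ1 : κ < 1) (hL : 0 < L) (ha : 0 < a) (hm : ∀ y, 0 ≤ y → 0 < m y) :
    ∃ (B ε : ℝ) (n : ℕ), 1 ≤ B ∧ 0 < ε ∧ ε ≤ 1 ∧ 1 ≤ n ∧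
      ∀ (lam f : ℝ → ℝ) (φ : ℝ → ℝ → ℝ) (h : Assumptions E lam f φ),
        MemClass E b r κ l L a m M lam f φ →
        Harris.Condition (postJumpKernel h) E (weight E a b f) B ε n := by
  have hq0 : 0 < κ ^ (b + 1) := Real.rpow_pos_of_pos hκ _
  have hq1 : κ ^ (b + 1) < 1 := Real.rpow_lt_one hκ.le hκ1 (by linarith)
  have h1κ := sub_pos.2 hκ1
  obtain ⟨B, hB, hdrift⟩ := exists_drift_constant hq1 hq0 (potential a b r)
  -- On the sublevel set `𝕍 ≤ 16 B` one has `f x < c₀`, and `N` is chosen so that `N` decrements of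
  -- size `κ η` cover `c₀`.
  obtain ⟨c₀, hc₀⟩ := ((tendsto_potential ha hb).eventually_gt_atTop (Real.log (16 * B))).exists_forall_of_atTop
  set η := r * (1 - κ) / 2 with hη
  have hη0 : 0 < η := by positivity
  obtain ⟨N, hN⟩ := exists_nat_ge (c₀ / (κ * η))
  set δ := 1 - Real.exp (-potential a b η) with hδ
  have hp : 0 < potential a b η := by unfold potential; positivity
  have hδ0 : 0 < δ := sub_pos.2 (Real.exp_lt_one_iff.2 (by linarith))
  have hδ1 : δ ≤ 1 := by have := Real.exp_pos (-potential a b η); linarith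
  -- `N + 1` jumps bring the chain below `r` with probability at least `δ ^ (N + 1)`; one further
  -- jump follows the law started from `r` with weight `exp (-L)`.
  refine ⟨B, δ ^ (N + 1) * Real.exp (-L), N + 1 + 1, hB, by positivity, ?_, by omega, ?_⟩
  · exact mul_le_one₀ (pow_le_one₀ hδ0.le hδ1) (Real.exp_pos _).le (Real.exp_le_one_iff.2 (by linarith))
  intro lam f φ h hc
  have hrE := h.mem_of_pos hr
  have hprob : ∀ x ∈ E, IsProbabilityMeasure (postJumpLaw E lam f φ x) := fun x hx =>
    h.postJumpLaw_isProbabilityMeasure hc.rate_continuousOn hx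
      (hc.tendsto_cumRate h ha hb hr hκ hκ1 hm hx)
  refine ⟨h.measurableSet, ⟨r, hrE⟩, hprob, fun x hx => h.postJumpLaw_ae_mem hx, ?_,
    h.measurable_weight, h.one_le_weight ha hb, ?_, postJumpLaw E lam f φ r, hprob r hrE, ?_⟩
  · intro x hx
    rw [postJumpKernel_apply, postJumpLaw, if_neg hx]
  · intro x hx
    refine (hc.lintegral_lyapunov_le h ha hb hr hκ hκ1 hm h.measurable_weight
      (fun z hz => weight_eq hz) hx).trans (ENNReal.ofReal_le_ofReal ?_)
    rw [weight_eq hx]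
    exact hdrift _
  · intro x hx hWx
    have hfx : f x ≤ κ * r + N * (κ * η) := by
      by_contra hlt
      push Not at hlt
      have h1 : c₀ ≤ f x := by
        rw [div_le_iff₀ (by positivity)] at hN
        have : 0 < κ * r := by positivity
        linarith
      have h2 := hc₀ _ h1
      rw [weight_eq hx] at hWx
      rw [Real.log_lt_iff_lt_exp (by linarith)] at h2
      exact absurd hWx (not_le.2 h2)
    have h1 := hc.le_postJumpKernel_pow_Iic h ha hb hr hκ hκ1 hm N x hx hfx
    have hae : ∀ᵐ z ∂((postJumpKernel h ^ (N + 1)) x), z ∈ E :=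
      Harris.ae_mem_pow h.measurableSet (fun x hx => h.postJumpLaw_ae_mem hx) _ x hx
    refine Measure.le_iff.2 fun A hA => ?_
    rw [Harris.pow_add_apply, pow_one, Kernel.comp_apply' _ _ _ hA, Measure.smul_apply,
      smul_eq_mul, ENNReal.ofReal_mul (by positivity), ENNReal.ofReal_pow hδ0.le]
    calc _ ≤ (postJumpKernel h ^ (N + 1)) x (Iic r) * ENNReal.ofReal (Real.exp (-L)) *
          postJumpLaw E lam f φ r A := by gcongr
      _ = ∫⁻ _z in Iic r, ENNReal.ofReal (Real.exp (-L)) * postJumpLaw E lam f φ r A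
            ∂((postJumpKernel h ^ (N + 1)) x) := by rw [setLIntegral_const]; ring
      _ ≤ ∫⁻ z in Iic r, postJumpKernel h z A ∂((postJumpKernel h ^ (N + 1)) x) := by
          refine lintegral_mono_ae ?_
          filter_upwards [ae_restrict_of_ae hae, ae_restrict_mem measurableSet_Iic] with z hz hzr
          exact Measure.le_iff.1 (hc.smul_postJumpLaw_le h hL hz hzr) A hA
      _ ≤ _ := setLIntegral_le_lintegral _ _

end PDMP

/-! ### The density of the invariant measure. -/

namespace PDMP

variable {E : Set ℝ} {lam f : ℝ → ℝ} {φ : ℝ → ℝ → ℝ} {b r κ l L a : ℝ} {m M : ℝ → ℝ}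

/-- The speed at which the location after a jump moves, when the process sits at `z`. -/
def speed (f : ℝ → ℝ) (φ : ℝ → ℝ → ℝ) (z : ℝ) : ℝ := derivWithin (fun t => f (φ z t)) (Ici 0) 0

/-- The hazard rate of the post-jump location. -/
def hazard (E : Set ℝ) (lam f : ℝ → ℝ) (φ : ℝ → ℝ → ℝ) (w : ℝ) : ℝ :=
  E.indicator (fun w => lam (Function.invFunOn f E w) *
    (speed f φ (Function.invFunOn f E w))⁻¹) w

namespace Assumptions

/-- By the semigroup property, the velocity along an orbit depends only on the current position.
This is why `g_x(w)` does not depend on `x`. -/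
theorem speed_flow (h : Assumptions E lam f φ) {x t : ℝ} (hx : x ∈ E) (ht : 0 ≤ t) :
    speed f φ (φ x t) = derivWithin (fun t => f (φ x t)) (Ici 0) t := by
  have h1 := (h.hasDerivWithinAt_postFlow hx ht).mono (Ici_subset_Ici.2 ht)
  have h2 : HasDerivWithinAt (fun s => s + t) 1 (Ici 0) 0 := (hasDerivWithinAt_id 0 _).add_const t
  rw [← zero_add t] at h1
  have h3 := HasDerivWithinAt.comp (h := fun s => s + t) 0 h1 h2 fun s hs => by
    simp only [mem_Ici, zero_add] at hs ⊢; linarith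
  rw [mul_one, zero_add] at h3
  refine HasDerivWithinAt.derivWithin ?_ (uniqueDiffOn_Ici 0 0 (mem_Ici.2 le_rfl))
  refine h3.congr (fun s hs => ?_) ?_
  · simp only [Function.comp]; rw [h.flow_add x hx t ht s hs]
  · simp only [Function.comp]; rw [h.flow_add x hx t ht 0 le_rfl]

theorem gFun_eq (h : Assumptions E lam f φ) {x w : ℝ} (hx : x ∈ E) (hxw : f x ≤ w) :
    gFun f φ x w = (speed f φ (Function.invFunOn f E w))⁻¹ := by
  obtain ⟨t, ht, rfl⟩ := h.exists_postFlow_eq hx hxw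
  rw [h.gFun_postFlow hx ht, h.invFunOn_jump (h.flow_mem hx ht), h.speed_flow hx ht]

theorem measurable_speed (h : Assumptions E lam f φ) : Measurable (E.domRestrict (speed f φ)) := by
  have hF := h.measurable_comp_flow h.jump_measurable
  -- The speed is a pointwise limit of difference quotients at times `1 / (n + 1)`, written in the
  -- form of `slope`, whence the `- 0`.
  have hu : ∀ n : ℕ, Measurable fun z : E =>
      ((1 / ((n : ℝ) + 1)) - 0)⁻¹ * (f (φ z (1 / ((n : ℝ) + 1))) - f (φ z 0)) := by
    intro n
    have h1 (t : ℝ) (ht : 0 ≤ t) : Measurable fun z : E => f (φ z t) := by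
      have := (hF.comp (measurable_prodMk_right (y := t))).comp (measurable_subtype_coe (p := (· ∈ E)))
      convert this using 1
      ext z
      simp [indicator, ht]
    exact ((h1 _ (by positivity)).sub (h1 0 le_rfl)).const_mul _
  refine measurable_of_tendsto_metrizable hu (tendsto_pi_nhds.2 fun z => ?_)
  have hd := h.hasDerivWithinAt_postFlow z.2 le_rfl
  rw [hasDerivWithinAt_iff_tendsto_slope] at hd
  have hs : Tendsto (fun n : ℕ => 1 / ((n : ℝ) + 1)) atTop (𝓝[Ici 0 \ {0}] 0) := by
    refine tendsto_nhdsWithin_iff.2 ⟨tendsto_one_div_add_atTop_nhds_zero_nat, ?_⟩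
    refine Eventually.of_forall fun n => ⟨?_, ?_⟩
    · exact mem_Ici.2 (by positivity)
    · have : (0 : ℝ) < 1 / ((n : ℝ) + 1) := by positivity
      exact this.ne'
  exact hd.comp hs

theorem measurable_hazard (h : Assumptions E lam f φ) : Measurable (hazard E lam f φ) := by
  refine measurable_indicator_of_restrict h.measurableSet ?_
  have hmono : Monotone fun w : E => Function.invFunOn f E w := by
    intro v w hvw
    refine (h.jump_le_jump (h.invFunOn_mem v.2) (h.invFunOn_mem w.2)).1 ?_
    rw [h.jump_invFunOn v.2, h.jump_invFunOn w.2]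
    exact hvw
  have hoc : OrdConnected E := ⟨fun x hx y _ z hz => h.mem_of_le hx hz.1⟩
  have hinv : Measurable fun w : E => (⟨Function.invFunOn f E w, h.invFunOn_mem w.2⟩ : E) :=
    hmono.measurable.subtype_mk
  exact (h.rate_measurable.comp hinv).mul (h.measurable_speed.comp hinv).inv

theorem speed_pos (h : Assumptions E lam f φ) {z : ℝ} (hz : z ∈ E) : 0 < speed f φ z :=
  h.derivWithin_postFlow_pos hz le_rfl

theorem hazard_nonneg (h : Assumptions E lam f φ) (w : ℝ) : 0 ≤ hazard E lam f φ w := by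
  refine indicator_nonneg (fun w hw => ?_) w
  exact mul_nonneg (h.rate_nonneg _ (h.invFunOn_mem hw))
    (inv_nonneg.2 (h.speed_pos (h.invFunOn_mem hw)).le)

theorem hazard_jump (h : Assumptions E lam f φ) {z : ℝ} (hz : z ∈ E) :
    hazard E lam f φ (f z) = lam z * (speed f φ z)⁻¹ := by
  rw [hazard, indicator_of_mem (h.jump_mem hz), h.invFunOn_jump hz]

/-- In the variable `w = f (φ x t)`, the factor `exp (-Λ(x, t))` is the probability of `Z₁ ≥ w`, and
`lam dt` becomes `hazard w dw`. The starting point enters only through the support and this survival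
probability. -/
theorem postJumpLaw_apply_eq_lintegral_hazard (h : Assumptions E lam f φ)
    (hlam : ContinuousOn lam E) {x : ℝ} (hx : x ∈ E)
    (htop : Tendsto (cumRate lam φ x) atTop atTop) {A : Set ℝ} (hA : MeasurableSet A) :
    postJumpLaw E lam f φ x A = ∫⁻ w in Ici (f x), ENNReal.ofReal (hazard E lam f φ w) *
      postJumpLaw E lam f φ x (Ici w) * A.indicator 1 w := by
  have himg : (fun t => f (φ x t)) '' Ici 0 = Ici (f x) := by
    refine Subset.antisymm ?_ fun w hw => h.exists_postFlow_eq hx hw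
    rintro _ ⟨t, ht, rfl⟩
    exact h.le_postFlow hx ht
  rw [← himg, lintegral_image_eq_lintegral_abs_deriv_mul measurableSet_Ici
    (fun t ht => h.hasDerivWithinAt_postFlow hx ht) (h.strictMonoOn_postFlow hx).injOn,
    h.postJumpLaw_apply hx hA]
  refine setLIntegral_congr_fun measurableSet_Ici fun t ht => ?_
  have hd := h.derivWithin_postFlow_pos hx ht
  have hφ := h.flow_mem hx ht
  have hl := h.rate_nonneg _ hφ
  rw [h.hazard_jump hφ, h.speed_flow hx ht, h.postJumpLaw_Ici hlam hx htop ht, abs_of_pos hd,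
    ← mul_assoc, ← mul_assoc, ← ENNReal.ofReal_mul hd.le, ← ENNReal.ofReal_mul (by positivity)]
  congr 3
  field_simp

end Assumptions

/-- The mass of the pairs `(Z₀, Z₁)` with `f Z₀ ≤ w ≤ Z₁`, for `Z₀ ∼ π`. -/
def crossing (E : Set ℝ) (lam f : ℝ → ℝ) (φ : ℝ → ℝ → ℝ) (π : Measure ℝ) (w : ℝ) : ENNReal :=
  ∫⁻ z, {z | z ∈ E ∧ f z ≤ w}.indicator (fun z => postJumpLaw E lam f φ z (Ici w)) z ∂π

namespace Assumptions

/-- Joint measurability in `(z, w)`, needed for Tonelli. As `f` is arbitrary outside `E`, the set is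
rewritten with `E.indicator f`. -/
theorem measurable_crossing_aux (h : Assumptions E lam f φ) [IsSFiniteKernel (postJumpKernel h)] :
    Measurable fun p : ℝ × ℝ => {z | z ∈ E ∧ f z ≤ p.2}.indicator
      (fun z => postJumpLaw E lam f φ z (Ici p.2)) p.1 := by
  have hT : MeasurableSet {q : (ℝ × ℝ) × ℝ | q.1.2 ≤ q.2} :=
    measurableSet_le (measurable_snd.comp measurable_fst) measurable_snd
  have h1 := Kernel.measurable_kernel_prodMk_left
    (κ := (postJumpKernel h).comap (Prod.fst : ℝ × ℝ → ℝ) measurable_fst) hT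
  have hS : MeasurableSet {p : ℝ × ℝ | p.1 ∈ E ∧ E.indicator f p.1 ≤ p.2} :=
    (measurable_fst h.measurableSet).inter
      (measurableSet_le (h.measurable_jump_indicator.comp measurable_fst) measurable_snd)
  convert h1.indicator hS using 1
  ext p
  by_cases hp : p.1 ∈ E
  · by_cases hp2 : f p.1 ≤ p.2
    · simp only [indicator, mem_ofPred_eq, hp, hp2, and_self, if_true, Kernel.comap_apply]
      rfl
    · simp [indicator, hp, hp2]
  · simp [indicator, hp]

theorem measurable_crossing (h : Assumptions E lam f φ) [IsSFiniteKernel (postJumpKernel h)]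
    (π : Measure ℝ) [SFinite π] : Measurable (crossing E lam f φ π) :=
  h.measurable_crossing_aux.lintegral_prod_left'

theorem crossing_le_one (π : Measure ℝ) [IsProbabilityMeasure π]
    (hprob : ∀ x ∈ E, IsProbabilityMeasure (postJumpLaw E lam f φ x)) (w : ℝ) :
    crossing E lam f φ π w ≤ 1 := by
  calc crossing E lam f φ π w ≤ ∫⁻ _z, 1 ∂π := by
        refine lintegral_mono fun z => ?_
        by_cases hz : z ∈ E ∧ f z ≤ w
        · have := hprob z hz.1
          rw [indicator_of_mem (by exact hz)]
          exact prob_le_one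
        · rw [indicator_of_notMem (by exact hz)]
          exact zero_le
    _ = 1 := by simp

/-- The density of an invariant probability measure. -/
theorem invariant_eq_densityMeasure (h : Assumptions E lam f φ) (hlam : ContinuousOn lam E)
    (htop : ∀ x ∈ E, Tendsto (cumRate lam φ x) atTop atTop)
    [IsSFiniteKernel (postJumpKernel h)] {π : Measure ℝ} [IsProbabilityMeasure π]
    (hπ : Kernel.Invariant (postJumpKernel h) π) :
    π = densityMeasure fun w => hazard E lam f φ w * (crossing E lam f φ π w).toReal := by
  have hprob := fun x hx => h.postJumpLaw_isProbabilityMeasure hlam hx (htop x hx)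
  refine Measure.ext fun A hA => ?_
  have hm : Measurable fun p : ℝ × ℝ => {z | z ∈ E ∧ f z ≤ p.2}.indicator
      (fun z => postJumpLaw E lam f φ z (Ici p.2)) p.1 * ENNReal.ofReal (hazard E lam f φ p.2) *
        A.indicator 1 p.2 :=
    (h.measurable_crossing_aux.mul (h.measurable_hazard.comp measurable_snd).ennreal_ofReal).mul
      ((measurable_one.indicator hA).comp measurable_snd)
  conv_lhs => rw [← hπ.def, Measure.bind_apply hA (postJumpKernel h).aemeasurable]
  -- After Tonelli, for fixed `w` the hazard does not depend on the starting point and leaves the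
  -- integral; what remains is `crossing`.
  calc ∫⁻ x, postJumpKernel h x A ∂π
      = ∫⁻ x, ∫⁻ w, {z | z ∈ E ∧ f z ≤ w}.indicator
          (fun z => postJumpLaw E lam f φ z (Ici w)) x * ENNReal.ofReal (hazard E lam f φ w) *
            A.indicator 1 w ∂volume ∂π := by
        refine lintegral_congr fun x => ?_
        by_cases hx : x ∈ E
        · rw [postJumpKernel_apply, h.postJumpLaw_apply_eq_lintegral_hazard hlam hx (htop x hx) hA,
            ← lintegral_indicator measurableSet_Ici]
          refine lintegral_congr fun w => ?_
          by_cases hw : f x ≤ w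
          · simp only [indicator, mem_ofPred_eq, mem_Ici, hx, hw, and_self, if_true]
            ring
          · simp [indicator, hw]
        · simp [postJumpKernel_apply, postJumpLaw, hx]
    _ = ∫⁻ w, ∫⁻ x, {z | z ∈ E ∧ f z ≤ w}.indicator
          (fun z => postJumpLaw E lam f φ z (Ici w)) x * ENNReal.ofReal (hazard E lam f φ w) *
            A.indicator 1 w ∂π := lintegral_lintegral_swap hm.aemeasurable
    _ = ∫⁻ w, A.indicator (fun w => ENNReal.ofReal
          (hazard E lam f φ w * (crossing E lam f φ π w).toReal)) w := by
        refine lintegral_congr fun w => ?_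
        have hmw : Measurable fun x => {z | z ∈ E ∧ f z ≤ w}.indicator
            (fun z => postJumpLaw E lam f φ z (Ici w)) x :=
          h.measurable_crossing_aux.comp (measurable_prodMk_right (y := w))
        have hne : crossing E lam f φ π w ≠ ⊤ :=
          ((crossing_le_one π hprob w).trans_lt ENNReal.one_lt_top).ne
        rw [lintegral_mul_const _ (hmw.mul_const _), lintegral_mul_const _ hmw]
        by_cases hw : w ∈ A
        · simp only [indicator_of_mem hw, Pi.one_apply, mul_one]
          rw [ENNReal.ofReal_mul (h.hazard_nonneg w), ENNReal.ofReal_toReal hne, mul_comm]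
          rfl
        · simp [hw]
    _ = _ := by
        rw [lintegral_indicator hA, densityMeasure, withDensity_apply _ hA]

/-- On the crossing event `gFun` takes a single value, the inverse speed at `y`; the expectation in
the identity is this constant times the probability of the event. -/
theorem indicator_gFun_ae_eq (h : Assumptions E lam f φ) {π : Measure ℝ} [SFinite π]
    [IsSFiniteKernel (postJumpKernel h)] (hE : ∀ᵐ x ∂π, x ∈ E) {y : ℝ} (hy : y ∈ E) :
    (fun p : ℝ × ℝ => {p : ℝ × ℝ | f p.1 ≤ f y ∧ f y ≤ p.2}.indicator
      (fun p => gFun f φ p.1 (f y)) p) =ᵐ[π.compProd (postJumpKernel h)]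
    {p : ℝ × ℝ | (p.1 ∈ E ∧ E.indicator f p.1 ≤ f y) ∧ f y ≤ p.2}.indicator
      (fun _ => (speed f φ y)⁻¹) := by
  filter_upwards [Measure.ae_compProd_of_ae_fst (postJumpKernel h) (p := (· ∈ E))
    h.measurableSet hE] with p hp
  by_cases h1 : f p.1 ≤ f y ∧ f y ≤ p.2
  · rw [indicator_of_mem (by exact h1), indicator_of_mem (by simpa [hp] using h1),
      h.gFun_eq hp h1.1, h.invFunOn_jump hy]
  · rw [indicator_of_notMem (by exact h1), indicator_of_notMem (by simpa [hp] using h1)]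

theorem measurableSet_crossing (h : Assumptions E lam f φ) (y : ℝ) :
    MeasurableSet {p : ℝ × ℝ | (p.1 ∈ E ∧ E.indicator f p.1 ≤ f y) ∧ f y ≤ p.2} :=
  ((measurable_fst h.measurableSet).inter
    (measurableSet_le (h.measurable_jump_indicator.comp measurable_fst) measurable_const)).inter
    (measurableSet_le measurable_const measurable_snd)

theorem compProd_crossing (h : Assumptions E lam f φ) (π : Measure ℝ) [SFinite π]
    [IsSFiniteKernel (postJumpKernel h)] (y : ℝ) :
    (π.compProd (postJumpKernel h))
      {p : ℝ × ℝ | (p.1 ∈ E ∧ E.indicator f p.1 ≤ f y) ∧ f y ≤ p.2} =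
      crossing E lam f φ π (f y) := by
  rw [Measure.compProd_apply (h.measurableSet_crossing y)]
  refine lintegral_congr fun z => ?_
  by_cases hz : z ∈ E ∧ f z ≤ f y
  · have : Prod.mk z ⁻¹' {p : ℝ × ℝ | (p.1 ∈ E ∧ E.indicator f p.1 ≤ f y) ∧ f y ≤ p.2} =
        Ici (f y) := by
      ext w; simp [hz.1, hz.2]
    rw [this, indicator_of_mem (by exact hz)]
    rfl
  · have : Prod.mk z ⁻¹' {p : ℝ × ℝ | (p.1 ∈ E ∧ E.indicator f p.1 ≤ f y) ∧ f y ≤ p.2} = ∅ := by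
      ext w
      simp only [mem_preimage, mem_ofPred_eq, mem_empty_iff_false, iff_false]
      rintro ⟨⟨h1, h2⟩, -⟩
      rw [indicator_of_mem h1] at h2
      exact hz ⟨h1, h2⟩
    rw [this, indicator_of_notMem (by exact hz)]
    simp

end Assumptions

end PDMP

end

/-! ### The main theorem. -/

theorem proposition1 (E : Set ℝ) (b r κ l L a : ℝ) (m M : ℝ → ℝ)
    (hb : 0 < b) (hr : 0 < r) (hκ : 0 < κ) (hκ1 : κ < 1) (hl : 0 < l) (hL : 0 < L) (ha : 0 < a)
    (hmM : ∀ y, 0 ≤ y → 0 < m y ∧ m y ≤ M y) :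
    ∃ γ R : ℝ, 0 < γ ∧ γ < 1 ∧
      ∀ (lam f : ℝ → ℝ) (φ : ℝ → ℝ → ℝ) (h : PDMP.Assumptions E lam f φ),
        PDMP.MemClass E b r κ l L a m M lam f φ →
        ∃ ν : ℝ → ℝ, Measurable ν ∧ (∀ y, 0 ≤ ν y) ∧ (∀ y, y ∉ E → ν y = 0) ∧
          -- `ν(x) dx` is the unique invariant probability measure
          IsProbabilityMeasure (PDMP.densityMeasure ν) ∧
          Kernel.Invariant (PDMP.postJumpKernel h) (PDMP.densityMeasure ν) ∧
          (∀ π : Measure ℝ, IsProbabilityMeasure π →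
            Kernel.Invariant (PDMP.postJumpKernel h) π → π = PDMP.densityMeasure ν) ∧
          -- `𝕍` is integrable and the chain is `𝕍`-geometrically ergodic
          Integrable (PDMP.lyapunov a b f) (PDMP.densityMeasure ν) ∧
          (∀ ψ : ℝ → ℝ, Measurable ψ → (∀ z ∈ E, |ψ z| ≤ PDMP.lyapunov a b f z) →
            ∀ x ∈ E, ∀ k : ℕ,
              Integrable ψ ((PDMP.postJumpKernel h ^ k) x) ∧
              |∫ z, ψ z ∂((PDMP.postJumpKernel h ^ k) x) - ∫ z, ψ z * ν z| ≤
                R * PDMP.lyapunov a b f x * γ ^ k) ∧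
          -- the identity for the invariant density; the pair `p` is `(Z₀, Z₁)`
          (∀ y ∈ E,
            Integrable (fun p : ℝ × ℝ => {p : ℝ × ℝ | f p.1 ≤ f y ∧ f y ≤ p.2}.indicator
                (fun p => PDMP.gFun f φ p.1 (f y)) p)
              ((PDMP.densityMeasure ν).compProd (PDMP.postJumpKernel h)) ∧
            lam y * ∫ p : ℝ × ℝ, {p : ℝ × ℝ | f p.1 ≤ f y ∧ f y ≤ p.2}.indicator
                (fun p => PDMP.gFun f φ p.1 (f y)) p
              ∂((PDMP.densityMeasure ν).compProd (PDMP.postJumpKernel h)) = ν (f y)) := by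
  have hm : ∀ y, 0 ≤ y → 0 < m y := fun y hy => (hmM y hy).1
  obtain ⟨B, ε, n, hB, hε, hε1, hn, hH⟩ :=
    PDMP.exists_harris_constants E l M hb hr hκ hκ1 hL ha hm
  refine ⟨Harris.rate B ε n, Harris.const B ε n, Harris.rate_pos hB hε1,
    Harris.rate_lt_one hB hε hε1 hn, fun lam f φ h hc => ?_⟩
  have htop : ∀ x ∈ E, Filter.Tendsto (PDMP.cumRate lam φ x) Filter.atTop Filter.atTop :=
    fun x hx => hc.tendsto_cumRate h ha hb hr hκ hκ1 hm hx
  have hprob : ∀ x ∈ E, IsProbabilityMeasure (PDMP.postJumpLaw E lam f φ x) :=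
    fun x hx => h.postJumpLaw_isProbabilityMeasure hc.rate_continuousOn hx (htop x hx)
  -- Finiteness of the kernel is what `compProd` and the Tonelli arguments require; off `E` it is
  -- the zero measure.
  have hfin : IsFiniteKernel (PDMP.postJumpKernel h) := by
    refine ⟨1, ENNReal.one_lt_top, fun x => ?_⟩
    rw [PDMP.postJumpKernel_apply]
    by_cases hx : x ∈ E
    · have := hprob x hx
      exact prob_le_one
    · simp [PDMP.postJumpLaw, hx]
  obtain ⟨π, hπ, hinv, hE, huniq, hWi, hconv⟩ :=
    (hH lam f φ h hc).exists_geometric_ergodic hB hε hε1 hn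
  set ν : ℝ → ℝ := fun w => PDMP.hazard E lam f φ w * (PDMP.crossing E lam f φ π w).toReal with hν
  have hνm : Measurable ν := h.measurable_hazard.mul (h.measurable_crossing π).ennreal_toReal
  have hν0 : ∀ y, 0 ≤ ν y := fun y => mul_nonneg (h.hazard_nonneg y) ENNReal.toReal_nonneg
  have hπν : π = PDMP.densityMeasure ν :=
    h.invariant_eq_densityMeasure hc.rate_continuousOn htop hinv
  have hint : ∀ ψ : ℝ → ℝ, ∫ z, ψ z ∂π = ∫ z, ψ z * ν z := by
    intro ψ
    rw [hπν, PDMP.densityMeasure, integral_withDensity_eq_integral_toReal_smul hνm.ennreal_ofReal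
      (ae_of_all _ fun _ => ENNReal.ofReal_lt_top)]
    refine integral_congr_ae (ae_of_all _ fun z => ?_)
    simp only [ENNReal.toReal_ofReal (hν0 z), smul_eq_mul, mul_comm]
  refine ⟨ν, hνm, hν0, fun y hy => ?_, ?_⟩
  · simp [hν, PDMP.hazard, hy]
  rw [← hπν]
  refine ⟨hπ, hinv, huniq, ?_, ?_, ?_⟩
  · refine hWi.congr ?_
    filter_upwards [hE] with z hz using PDMP.weight_eq hz
  · intro ψ hψ hψV x hx k
    have := hconv ψ hψ (fun z hz => (hψV z hz).trans_eq (PDMP.weight_eq hz).symm) x hx k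
    rwa [PDMP.weight_eq hx, hint] at this
  · intro y hy
    have hae := h.indicator_gFun_ae_eq hE hy
    have hT := h.measurableSet_crossing y
    refine ⟨Integrable.congr ((integrable_const _).indicator hT) hae.symm, ?_⟩
    -- Both sides reduce to `lam y` times the inverse speed at `y` times the crossing probability at
    -- `f y`, since `hazard (f y)` is the product of the first two.
    rw [integral_congr_ae hae, integral_indicator_const _ hT, measureReal_def,
      h.compProd_crossing, hν]
    simp only
    rw [h.hazard_jump hy, smul_eq_mul]
    ring
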